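/- Let $R$ be a finite reduced crystallographic root system with simple roots $\Delta$, in a finite-dimensional real vector space $V_0$ (containing, possibly strictly, the span of $R$), with coroots $\alpha^\vee\in\operatorname{Hom}_{\mathbb R}(V_0,\mathbb R)$, Weyl group $W$ generated by the reflections $s_\alpha(v)=v-\langle v,\alpha^\vee\rangle\alpha$, and longest element $w_0\in W$. Let $V=\mathbb C\otimes_{\mathbb R}V_0$ and let $k:\Delta\to\mathbb R$ be constant on simple roots lying in the same $W$-orbit. Let $\mathbb H$ be the graded affine Hecke algebra: the unital associative $\mathbb C$-algebra generated by symbols $t_w$ ($w\in W$) and $v\in V$, subject to the relations that $w\mapsto t_w$ and $v\mapsto v$ extend to algebra homomorphisms $\mathbb C[W]\to\mathbb H$ and $S(V)\to\mathbb H$, and $$t_{s_\alpha}v-s_\alpha(v)t_{s_\alpha}=k_\alpha\langle v,\alpha^\vee\rangle\qquad(\alpha\in\Delta,\ v\in V).$$ Let $\theta$ be the involution of $\mathbb H$ with $\theta(v)=-w_0(v)$ and $\theta(t_w)=t_{w_0ww_0^{-1}}$, and let $\mathbb H\rtimes\langle\theta\rangle$ be the skew group algebra of the group $\langle\theta\rangle$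 of order two (also when $\theta$ acts trivially on $\mathbb H$), so that $\theta h=\theta(h)\theta$ for $h\in\mathbb H$. For finite-dimensional $\mathbb H\rtimes\langle\theta\rangle$-modules $X,Y$ let $\operatorname{Ext}^i_{\mathbb H\rtimes\langle\theta\rangle}(X,Y)$ and $\operatorname{Ext}^i_{\mathbb H}(X,Y)$ denote the Ext groups in the categories of $\mathbb H\rtimes\langle\theta\rangle$-modules and of $\mathbb H$-modules, respectively. For an $\mathbb H$-module $M$ let $M^\theta$ be the same vector space with $h$ acting as $\theta(h)$ acts on $M$. Let $\theta^*$ be the natural map on $\operatorname{Ext}^i_{\mathbb H}(X,Y)$ induced by the action of $\theta$ on $X$ and $Y$, that is, the composite $$\operatorname{Ext}^i_{\mathbb H}(X,Y)\to\operatorname{Ext}^i_{\mathbb H}(X^\theta,Y^\theta)\to\operatorname{Ext}^i_{\mathbb H}(X,Y)$$ of the map induced by the exact functor $M\mapsto M^\theta$ and the map induced by the $\mathbb H$-isomorphisms $\theta:X\to X^\theta$ and $\theta:Y^\theta\to Y$ (for $i=0$ it is $\psi\mapsto\theta\circ\psi\circ\theta$). Put $$\mathrm{EP}_{\mathbb H}(X,Y)=\sum_i(-1)^i\dim\operatorname{Ext}^i_{\mathbb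 H}(X,Y),\qquad \mathrm{EP}_{\mathbb H\rtimes\langle\theta\rangle}(X,Y)=\sum_i(-1)^i\dim\operatorname{Ext}^i_{\mathbb H\rtimes\langle\theta\rangle}(X,Y),$$ $$\mathrm{EP}^\theta_{\mathbb H}(X,Y)=\sum_i(-1)^i\operatorname{tr}\bigl(\theta^*\mid\operatorname{Ext}^i_{\mathbb H}(X,Y)\bigr).$$ Then for all finite-dimensional $\mathbb H\rtimes\langle\theta\rangle$-modules $X$ and $Y$, the spaces $\operatorname{Ext}^i_{\mathbb H}(X,Y)$ and $\operatorname{Ext}^i_{\mathbb H\rtimes\langle\theta\rangle}(X,Y)$ are finite-dimensional for all $i\ge 0$ and vanish for all sufficiently large $i$; for every $i\ge0$ $$\dim\operatorname{Ext}^i_{\mathbb H\rtimes\langle\theta\rangle}(X,Y)=\tfrac12\dim\operatorname{Ext}^i_{\mathbb H}(X,Y)+\tfrac12\operatorname{tr}\bigl(\theta^*\mid\operatorname{Ext}^i_{\mathbb H}(X,Y)\bigr);$$ and $$\mathrm{EP}_{\mathbb H\rtimes\langle\theta\rangle}(X,Y)=\tfrac12\,\mathrm{EP}_{\mathbb H}(X,Y)+\tfrac12\,\mathrm{EP}^\theta_{\mathbb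 H}(X,Y).$$ -/

import Mathlib

universe u

set_option linter.unusedSectionVars false

open CategoryTheory
open scoped TensorProduct ModuleCat

noncomputable section

namespace GradedHecke

section Weyl

variable {ι V₀ N : Type u} [AddCommGroup V₀] [Module ℝ V₀] [AddCommGroup N] [Module ℝ N]
  {P : RootPairing ι ℝ V₀ N}

/-- The simple reflection `s_α` in the Weyl group attached to a simple root `α`. -/
def simpleReflection (b : P.Base) (i : b.support) : P.weylGroup :=
  RootPairing.weylGroup.ofIdx P i

/-- The length of a Weyl group element: the least number of factors in an expression of `w` as a
product of simple reflections. -/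
def length (b : P.Base) (w : P.weylGroup) : ℕ :=
  sInf {n | ∃ l : List b.support, l.length = n ∧ (l.map (simpleReflection b)).prod = w}

theorem root_smul (w : P.weylGroup) (i : ι) : P.root (w • i) = w • P.root i :=
  (P.weylGroup_apply_root w i).symm

theorem ofIdx_smul_idx (i j : ι) :
    RootPairing.weylGroup.ofIdx P i • j = P.reflectionPerm i j := rfl

theorem ofIdx_smul_vec (i : ι) (x : V₀) :
    RootPairing.weylGroup.ofIdx P i • x = P.reflection i x := rfl

theorem weyl_ext {w w' : P.weylGroup} (h : ∀ x : V₀, w • x = w' • x) : w = w' := by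
  apply Subtype.ext
  apply RootPairing.Equiv.weightHom_injective P
  ext x
  exact h x

theorem coroot'_smul (w : P.weylGroup) (i : ι) (x : V₀) :
    P.coroot' (w • i) (w • x) = P.coroot' i x := by
  have h1 := congrFun (w.1.toHom.coroot_coweightMap) (w • i)
  have h2 := LinearMap.congr_fun
    (RootPairing.Hom.weight_coweight_transpose_apply P P (P.coroot (w • i)) w.1.toHom) x
  have h3 : w.1.toHom.indexEquiv.symm (w • i) = i :=
    w.1.toHom.indexEquiv.symm_apply_apply i
  simp only [Function.comp_apply] at h1
  rw [h1, h3] at h2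
  exact h2

theorem conj_ofIdx (w : P.weylGroup) (i : ι) :
    w * RootPairing.weylGroup.ofIdx P i * w⁻¹ = RootPairing.weylGroup.ofIdx P (w • i) := by
  apply weyl_ext
  intro x
  rw [mul_smul, mul_smul, ofIdx_smul_vec, ofIdx_smul_vec, RootPairing.reflection_apply,
    RootPairing.reflection_apply, smul_sub, smul_inv_smul, smul_comm, root_smul,
    ← coroot'_smul w i (w⁻¹ • x), smul_inv_smul]

theorem ofIdx_mul_self (i : ι) :
    RootPairing.weylGroup.ofIdx P i * RootPairing.weylGroup.ofIdx P i = 1 := by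
  apply weyl_ext
  intro x
  rw [mul_smul, ofIdx_smul_vec, ofIdx_smul_vec, one_smul]
  simp

theorem ofIdx_inv (i : ι) :
    (RootPairing.weylGroup.ofIdx P i)⁻¹ = RootPairing.weylGroup.ofIdx P i :=
  inv_eq_of_mul_eq_one_right (ofIdx_mul_self i)

/-- The index of the root `-α`. -/
def negIdx (P : RootPairing ι ℝ V₀ N) (i : ι) : ι := P.reflectionPerm i i

theorem root_negIdx (i : ι) : P.root (negIdx P i) = -P.root i := by
  simp [negIdx, RootPairing.root_reflectionPerm]

theorem isPos_negIdx_iff (b : P.Base) (i : ι) : b.IsPos (negIdx P i) ↔ ¬ b.IsPos i :=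
  RootPairing.Base.IsPos.neg_iff_not b i

theorem smul_negIdx (w : P.weylGroup) (i : ι) : w • negIdx P i = negIdx P (w • i) := by
  apply P.root.injective
  rw [root_smul, root_negIdx, root_negIdx, smul_neg, root_smul]

theorem ofIdx_negIdx (i : ι) :
    RootPairing.weylGroup.ofIdx P (negIdx P i) = RootPairing.weylGroup.ofIdx P i := by
  have h := conj_ofIdx (RootPairing.weylGroup.ofIdx P i) i
  rw [ofIdx_inv, mul_assoc, ofIdx_mul_self, mul_one] at h
  exact h.symm

variable [Finite ι]

instance finite_weylGroup : Finite P.weylGroup := by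
  have := Fintype.ofFinite ι
  have hinj : Function.Injective (fun (w : P.weylGroup) (i : ι) ↦ w • i) := by
    intro w w' h
    have key : ∀ (g : P.weylGroup), ∀ c ∈ LinearMap.ker P.RootForm, g • c = c := by
      intro g c hc
      obtain ⟨g, hg⟩ := g
      induction hg using RootPairing.weylGroup.induction with
      | mem i =>
        change P.reflection i c = c
        rw [RootPairing.reflection_apply]
        have h0 : P.coroot' i c = 0 := by
          have := P.ker_rootForm_eq_dualAnnihilator
          rw [this, P.corootSpan_dualAnnihilator_map_eq_iInf_ker_coroot'] at hc
          simpa using (Submodule.mem_iInf _).1 hc i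
        simp [h0]
      | one => exact one_smul _ c
      | mul g₁ g₂ h₁ h₂ e₁ e₂ =>
        have : (⟨g₁ * g₂, mul_mem h₁ h₂⟩ : P.weylGroup) = ⟨g₁, h₁⟩ * ⟨g₂, h₂⟩ := rfl
        rw [this, mul_smul, e₂, e₁]
    apply weyl_ext
    intro x
    obtain ⟨a, ha, c, hc, rfl⟩ := Submodule.mem_sup.1
      (P.isCompl_rootSpan_ker_rootForm.sup_eq_top ▸ (Submodule.mem_top : x ∈ ⊤))
    rw [smul_add, smul_add, key w c hc, key w' c hc]
    congr 1
    induction ha using Submodule.span_induction with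
    | mem y hy =>
      obtain ⟨i, rfl⟩ := hy
      rw [← root_smul, ← root_smul]
      exact congrArg P.root (congrFun h i)
    | zero => simp
    | add y z _ _ hy hz => rw [smul_add, smul_add, hy, hz]
    | smul r y _ hy => rw [smul_comm w, hy, ← smul_comm w']
  exact Finite.of_injective _ hinj

variable [P.IsCrystallographic] [P.IsReduced] (b : P.Base)

theorem exists_word (w : P.weylGroup) :
    ∃ l : List b.support, (l.map (simpleReflection b)).prod = w := by
  let S : Submonoid P.weylGroup := Submonoid.closure (Set.range (simpleReflection b))
  have hS : ∀ i, RootPairing.weylGroup.ofIdx P i ∈ S := by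
    intro i
    refine b.induction_reflect i (p := fun i ↦ RootPairing.weylGroup.ofIdx P i ∈ S) ?_ ?_ ?_
    · intro i hi
      exact (ofIdx_negIdx (P := P) i).symm ▸ hi
    · intro i hi
      exact Submonoid.subset_closure ⟨⟨i, hi⟩, rfl⟩
    · intro i j hi hj
      have hj' : RootPairing.weylGroup.ofIdx P j ∈ S := Submonoid.subset_closure ⟨⟨j, hj⟩, rfl⟩
      have h := conj_ofIdx (RootPairing.weylGroup.ofIdx P j) i
      rw [ofIdx_inv] at h
      change RootPairing.weylGroup.ofIdx P (RootPairing.weylGroup.ofIdx P j • i) ∈ S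
      rw [← h]
      exact mul_mem (mul_mem hj' hi) hj'
  have hw : w ∈ S := by
    obtain ⟨w, hw⟩ := w
    induction hw using RootPairing.weylGroup.induction with
    | mem i => exact hS i
    | one => exact one_mem S
    | mul g₁ g₂ h₁ h₂ e₁ e₂ => exact mul_mem e₁ e₂
  obtain ⟨l, hl, hl'⟩ := Submonoid.exists_list_of_mem_closure hw
  choose f hf using hl
  refine ⟨l.attach.map (fun x ↦ f x.1 x.2), ?_⟩
  rw [← hl', List.map_map]
  congr 1
  conv_rhs => rw [← List.attach_map_subtype_val l]
  apply List.map_congr_left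
  intro x _
  exact hf x.1 x.2

theorem exists_reduced_word (w : P.weylGroup) :
    ∃ l : List b.support, l.length = length b w ∧ (l.map (simpleReflection b)).prod = w := by
  obtain ⟨l, hl⟩ := exists_word b w
  exact Nat.sInf_mem (s := {n | ∃ l : List b.support, l.length = n ∧
    (l.map (simpleReflection b)).prod = w}) ⟨_, l, rfl, hl⟩

theorem length_prod_le (l : List b.support) :
    length b (l.map (simpleReflection b)).prod ≤ l.length :=
  Nat.sInf_le ⟨l, rfl, rfl⟩

/-- Deletion: a word sending a simple root to a negative root loses a letter after
multiplication by the corresponding simple reflection. -/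
theorem exists_shorter (l : List b.support) (i : b.support)
    (h : ¬ b.IsPos ((l.map (simpleReflection b)).prod • (i : ι))) :
    ∃ l' : List b.support, l'.length + 1 = l.length ∧
      (l'.map (simpleReflection b)).prod =
        (l.map (simpleReflection b)).prod * simpleReflection b i := by
  induction l with
  | nil =>
    simp only [List.map_nil, List.prod_nil, one_smul] at h
    exact absurd (RootPairing.Base.isPos_of_mem_support i.2) h
  | cons j l ih =>
    simp only [List.map_cons, List.prod_cons] at h ⊢
    set g := (l.map (simpleReflection b)).prod with hg
    by_cases hpos : b.IsPos (g • (i : ι))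
    · have hj : g • (i : ι) = j := by
        by_contra hne
        exact h (by rw [mul_smul]; exact hpos.reflectionPerm j.2 hne)
      refine ⟨l, by simp, ?_⟩
      rw [← hg]
      have hc := conj_ofIdx g i
      rw [hj] at hc
      change g = RootPairing.weylGroup.ofIdx P j * g * RootPairing.weylGroup.ofIdx P i
      rw [← hc, inv_mul_cancel_right, mul_assoc, ofIdx_mul_self, mul_one]
    · obtain ⟨l', h1, h2⟩ := ih hpos
      refine ⟨j :: l', by simp [h1], ?_⟩
      simp only [List.map_cons, List.prod_cons, h2, mul_assoc]

theorem length_lt_of_isPos (w : P.weylGroup) (i : b.support) (h : b.IsPos (w • (i : ι))) :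
    length b w < length b (w * simpleReflection b i) := by
  obtain ⟨l, hl, hw⟩ := exists_reduced_word b (w * simpleReflection b i)
  have hneg : ¬ b.IsPos ((l.map (simpleReflection b)).prod • (i : ι)) := by
    rw [hw, mul_smul]
    change ¬ b.IsPos (w • negIdx P i)
    rw [smul_negIdx, isPos_negIdx_iff, not_not]
    exact h
  obtain ⟨l', h1, h2⟩ := exists_shorter b l i hneg
  have h3 := length_prod_le b l'
  rw [h2, hw, mul_assoc] at h3
  change length b (w * (RootPairing.weylGroup.ofIdx P i * RootPairing.weylGroup.ofIdx P i)) ≤ _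
    at h3
  rw [ofIdx_mul_self, mul_one] at h3
  omega

theorem eq_one_of_forall_isPos (w : P.weylGroup) (h : ∀ i : b.support, b.IsPos (w • (i : ι))) :
    w = 1 := by
  obtain ⟨l, hl, hw⟩ := exists_reduced_word b w
  rcases List.eq_nil_or_concat l with rfl | ⟨l', i, rfl⟩
  · simpa using hw.symm
  · exfalso
    have h1 := length_lt_of_isPos b w i (h i)
    have h2 : w * simpleReflection b i = (l'.map (simpleReflection b)).prod := by
      rw [← hw]
      simp only [List.concat_eq_append, List.map_append, List.prod_append, List.map_cons,
        List.map_nil, List.prod_cons, List.prod_nil, mul_one, mul_assoc]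
      change _ * (RootPairing.weylGroup.ofIdx P i * RootPairing.weylGroup.ofIdx P i) = _
      rw [ofIdx_mul_self, mul_one]
    have h3 := length_prod_le b l'
    rw [← h2] at h3
    simp at hl
    omega

/-- The longest element `w₀` of the Weyl group: an element of maximal length. -/
def longestElement : P.weylGroup :=
  Classical.choose (Finite.exists_max (length b))

theorem length_le_longestElement (w : P.weylGroup) :
    length b w ≤ length b (longestElement b) :=
  Classical.choose_spec (Finite.exists_max (length b)) w

theorem not_isPos_longestElement_simple (i : b.support) :
    ¬ b.IsPos (longestElement b • (i : ι)) := fun h ↦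
  absurd (length_lt_of_isPos b _ i h) (not_lt.2 (length_le_longestElement b _))

theorem height_negIdx (i : ι) : b.height (negIdx P i) = -b.height i :=
  b.height_reflectionPerm_self i

theorem not_isPos_longestElement {i : ι} (hi : b.IsPos i) :
    ¬ b.IsPos (longestElement b • i) := by
  refine hi.induction_on_add (p := fun i ↦ ¬ b.IsPos (longestElement b • i)) ?_ ?_
  · exact fun i hi ↦ not_isPos_longestElement_simple b ⟨i, hi⟩
  · intro i j k hk h1 hj h2
    have hj' := not_isPos_longestElement_simple b ⟨j, hj⟩
    have : b.height (longestElement b • k) =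
        b.height (longestElement b • i) + b.height (longestElement b • j) := by
      apply b.height_add
      rw [root_smul, root_smul, root_smul, hk, smul_add]
    simp only [RootPairing.Base.isPos_iff] at *
    omega

theorem longestElement_mul_self : longestElement b * longestElement b = 1 := by
  apply eq_one_of_forall_isPos b
  intro i
  have h := not_isPos_longestElement b (i := negIdx P (longestElement b • (i : ι)))
    ((isPos_negIdx_iff b _).2 (not_isPos_longestElement_simple b i))
  rw [smul_negIdx, isPos_negIdx_iff, not_not] at h
  rw [mul_smul]
  exact h

theorem longestElement_inv : (longestElement b)⁻¹ = longestElement b :=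
  inv_eq_of_mul_eq_one_right (longestElement_mul_self b)

theorem negIdx_longestElement_mem (i : b.support) :
    negIdx P (longestElement b • (i : ι)) ∈ b.support := by
  have hpos : ∀ j, b.IsPos j → 0 < b.height (negIdx P (longestElement b • j)) := fun j hj ↦
    (isPos_negIdx_iff b _).2 (not_isPos_longestElement b hj)
  set γ := negIdx P (longestElement b • (i : ι)) with hγ
  have hγpos : b.IsPos γ := (isPos_negIdx_iff b _).2 (not_isPos_longestElement_simple b i)
  have hback : negIdx P (longestElement b • γ) = i := by
    apply P.root.injective
    rw [root_negIdx, root_smul, hγ, root_negIdx, root_smul, smul_neg, neg_neg, ← mul_smul,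
      longestElement_mul_self, one_smul]
  have key : b.IsPos γ ∧ (γ ∈ b.support ∨
      ∃ j k, b.IsPos j ∧ b.IsPos k ∧ P.root γ = P.root j + P.root k) := by
    refine hγpos.induction_on_add (p := fun γ ↦ b.IsPos γ ∧ (γ ∈ b.support ∨
      ∃ j k, b.IsPos j ∧ b.IsPos k ∧ P.root γ = P.root j + P.root k)) ?_ ?_
    · exact fun j hj ↦ ⟨RootPairing.Base.isPos_of_mem_support hj, Or.inl hj⟩
    · intro j k l hl h1 hk
      have hk' := RootPairing.Base.isPos_of_mem_support hk
      exact ⟨h1.1.add hk' hl, Or.inr ⟨j, k, h1.1, hk', hl⟩⟩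
  rcases key.2 with h | ⟨j, k, hj, hk, hjk⟩
  · exact h
  · exfalso
    have h1 : b.height (negIdx P (longestElement b • γ)) =
        b.height (negIdx P (longestElement b • j)) +
          b.height (negIdx P (longestElement b • k)) := by
      apply b.height_add
      simp only [root_negIdx, root_smul, hjk, smul_add, neg_add]
    rw [hback, RootPairing.Base.height_one_of_mem_support i.2] at h1
    have := hpos j hj
    have := hpos k hk
    omega

/-- The action `α ↦ -w₀(α)` of `θ` on the set of simple roots. -/
def thetaSimple (i : b.support) : b.support :=
  ⟨negIdx P (longestElement b • (i : ι)), negIdx_longestElement_mem b i⟩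

end Weyl

section Algebra

variable {ι V₀ N : Type u} [AddCommGroup V₀] [Module ℝ V₀] [AddCommGroup N] [Module ℝ N]
  {P : RootPairing ι ℝ V₀ N}

/-- A real parameter function on the simple roots, constant on simple roots in the same orbit of
the Weyl group. -/
structure ParameterFunction (b : P.Base) where
  toFun : b.support → ℝ
  invariant : ∀ i j : b.support, (∃ w : P.weylGroup, w • P.root i = P.root j) → toFun i = toFun j

/-- The action of the Weyl group on `V = ℂ ⊗ V₀`, extended complex-linearly from `V₀`. -/
def weylAct (w : P.weylGroup) : (ℂ ⊗[ℝ] V₀) →ₗ[ℂ] (ℂ ⊗[ℝ] V₀) :=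
  (P.weylGroupRootRep w).baseChange ℂ

/-- The complex-linear functional `⟨·, α^∨⟩` on `V = ℂ ⊗ V₀`. -/
def corootForm (P : RootPairing ι ℝ V₀ N) (i : ι) : (ℂ ⊗[ℝ] V₀) →ₗ[ℂ] ℂ :=
  (P.coroot' i).baseChange ℂ

/-- The generating symbols of the graded affine Hecke algebra: `t_w` for `w ∈ W`, and `f_v` for
`v ∈ V = ℂ ⊗ V₀`. -/
inductive Gen (P : RootPairing ι ℝ V₀ N) : Type u
  | t (w : P.weylGroup) : Gen P
  | f (v : ℂ ⊗[ℝ] V₀) : Gen P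

/-- The free generator `t_w`. -/
abbrev preT (w : P.weylGroup) : FreeAlgebra ℂ (Gen P) := FreeAlgebra.ι ℂ (Gen.t w)

/-- The free generator `f_v`. -/
abbrev preF (P : RootPairing ι ℝ V₀ N) (v : ℂ ⊗[ℝ] V₀) : FreeAlgebra ℂ (Gen P) :=
  FreeAlgebra.ι ℂ (Gen.f v)

/-- The defining relations: `w ↦ t_w` extends to an algebra homomorphism on `ℂ[W]`, `v ↦ f_v`
extends to an algebra homomorphism on `S(V)`, and
`t_{s_α} v - s_α(v) t_{s_α} = k_α ⟨v, α^∨⟩` for all simple roots `α` and `v ∈ V`. -/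
inductive Rel (b : P.Base) (k : ParameterFunction b) :
    FreeAlgebra ℂ (Gen P) → FreeAlgebra ℂ (Gen P) → Prop
  | t_one : Rel b k (preT 1) 1
  | t_mul (w w' : P.weylGroup) : Rel b k (preT (w * w')) (preT w * preT w')
  | f_add (v v' : ℂ ⊗[ℝ] V₀) : Rel b k (preF P (v + v')) (preF P v + preF P v')
  | f_smul (c : ℂ) (v : ℂ ⊗[ℝ] V₀) : Rel b k (preF P (c • v)) (c • preF P v)
  | f_comm (v v' : ℂ ⊗[ℝ] V₀) : Rel b k (preF P v * preF P v') (preF P v' * preF P v)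
  | cross (i : b.support) (v : ℂ ⊗[ℝ] V₀) :
      Rel b k (preT (simpleReflection b i) * preF P v -
          preF P (weylAct (simpleReflection b i) v) * preT (simpleReflection b i))
        (algebraMap ℂ _ ((k.toFun i : ℂ) * corootForm P i v))

/-- The graded affine Hecke algebra `ℍ` of the root datum (with fixed simple roots) and the
parameter function `k`. -/
def HeckeAlgebra (b : P.Base) (k : ParameterFunction b) : Type u := RingQuot (Rel b k)

variable {b : P.Base} {k : ParameterFunction b}

instance : Ring (HeckeAlgebra b k) := inferInstanceAs (Ring (RingQuot (Rel b k)))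

instance : Algebra ℂ (HeckeAlgebra b k) := inferInstanceAs (Algebra ℂ (RingQuot (Rel b k)))

/-- The projection from the free algebra. -/
def HeckeAlgebra.mk (b : P.Base) (k : ParameterFunction b) :
    FreeAlgebra ℂ (Gen P) →ₐ[ℂ] HeckeAlgebra b k :=
  RingQuot.mkAlgHom ℂ (Rel b k)

/-- The element `t_w` of `ℍ`. -/
def HeckeAlgebra.t (b : P.Base) (k : ParameterFunction b) (w : P.weylGroup) : HeckeAlgebra b k :=
  HeckeAlgebra.mk b k (preT w)

/-- The element `f_v` of `ℍ`, usually written `v`. -/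
def HeckeAlgebra.f (b : P.Base) (k : ParameterFunction b) (v : ℂ ⊗[ℝ] V₀) : HeckeAlgebra b k :=
  HeckeAlgebra.mk b k (preF P v)

namespace HeckeAlgebra

theorem mk_rel {x y : FreeAlgebra ℂ (Gen P)} (h : Rel b k x y) : mk b k x = mk b k y :=
  RingQuot.mkAlgHom_rel ℂ h

theorem t_one : t b k 1 = 1 := by
  simpa [t] using mk_rel (Rel.t_one (k := k))

theorem t_mul (w w' : P.weylGroup) : t b k (w * w') = t b k w * t b k w' := by
  simpa [t] using mk_rel (Rel.t_mul (k := k) w w')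

theorem f_add (v v' : ℂ ⊗[ℝ] V₀) : f b k (v + v') = f b k v + f b k v' := by
  simpa [f] using mk_rel (Rel.f_add (k := k) v v')

theorem f_smul (c : ℂ) (v : ℂ ⊗[ℝ] V₀) : f b k (c • v) = c • f b k v := by
  simpa [f] using mk_rel (Rel.f_smul (k := k) c v)

theorem f_comm (v v' : ℂ ⊗[ℝ] V₀) : f b k v * f b k v' = f b k v' * f b k v := by
  simpa [f] using mk_rel (Rel.f_comm (k := k) v v')

theorem t_mul_f (i : b.support) (v : ℂ ⊗[ℝ] V₀) :
    t b k (simpleReflection b i) * f b k v -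
        f b k (weylAct (simpleReflection b i) v) * t b k (simpleReflection b i) =
      algebraMap ℂ _ ((k.toFun i : ℂ) * corootForm P i v) := by
  have h := mk_rel (Rel.cross (k := k) i v)
  rw [map_sub, map_mul, map_mul, AlgHom.commutes] at h
  exact h

/-- The universal property of `ℍ`. -/
def lift {A : Type*} [Ring A] [Algebra ℂ A] (T : P.weylGroup → A) (F : (ℂ ⊗[ℝ] V₀) → A)
    (h₁ : T 1 = 1) (h₂ : ∀ w w', T (w * w') = T w * T w')
    (h₃ : ∀ v v', F (v + v') = F v + F v') (h₄ : ∀ (c : ℂ) v, F (c • v) = c • F v)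
    (h₅ : ∀ v v', F v * F v' = F v' * F v)
    (h₆ : ∀ (i : b.support) v, T (simpleReflection b i) * F v -
      F (weylAct (simpleReflection b i) v) * T (simpleReflection b i) =
        algebraMap ℂ A ((k.toFun i : ℂ) * corootForm P i v)) :
    HeckeAlgebra b k →ₐ[ℂ] A :=
  RingQuot.liftAlgHom ℂ ⟨FreeAlgebra.lift ℂ (fun g ↦ Gen.rec T F g), by
    intro x y h
    cases h with
    | t_one => simpa using h₁
    | t_mul w w' => simpa using h₂ w w'
    | f_add v v' => simpa using h₃ v v'
    | f_smul c v => simpa using h₄ c v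
    | f_comm v v' => simpa using h₅ v v'
    | cross i v =>
      rw [map_sub, map_mul, map_mul, AlgHom.commutes]
      simpa using h₆ i v⟩

theorem lift_t {A : Type*} [Ring A] [Algebra ℂ A] (T : P.weylGroup → A) (F : (ℂ ⊗[ℝ] V₀) → A)
    (h₁ h₂ h₃ h₄ h₅ h₆) (w : P.weylGroup) :
    lift (b := b) (k := k) T F h₁ h₂ h₃ h₄ h₅ h₆ (t b k w) = T w :=
  (RingQuot.liftAlgHom_mkAlgHom_apply ℂ _ _ _).trans (FreeAlgebra.lift_ι_apply _ _)

theorem lift_f {A : Type*} [Ring A] [Algebra ℂ A] (T : P.weylGroup → A) (F : (ℂ ⊗[ℝ] V₀) → A)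
    (h₁ h₂ h₃ h₄ h₅ h₆) (v : ℂ ⊗[ℝ] V₀) :
    lift (b := b) (k := k) T F h₁ h₂ h₃ h₄ h₅ h₆ (f b k v) = F v :=
  (RingQuot.liftAlgHom_mkAlgHom_apply ℂ _ _ _).trans (FreeAlgebra.lift_ι_apply _ _)

theorem algHom_ext {A : Type*} [Ring A] [Algebra ℂ A] {φ ψ : HeckeAlgebra b k →ₐ[ℂ] A}
    (ht : ∀ w, φ (t b k w) = ψ (t b k w)) (hf : ∀ v, φ (f b k v) = ψ (f b k v)) : φ = ψ := by
  apply RingQuot.ringQuot_ext'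
  apply FreeAlgebra.hom_ext
  funext g
  cases g with
  | t w => exact ht w
  | f v => exact hf v

end HeckeAlgebra

theorem weylAct_mul (w w' : P.weylGroup) (v : ℂ ⊗[ℝ] V₀) :
    weylAct (w * w') v = weylAct w (weylAct w' v) := by
  rw [weylAct, map_mul, Module.End.mul_eq_comp, LinearMap.baseChange_comp]
  rfl

theorem weylAct_one (v : ℂ ⊗[ℝ] V₀) : weylAct (1 : P.weylGroup) v = v := by
  rw [weylAct, map_one, Module.End.one_eq_id, LinearMap.baseChange_id]
  rfl

theorem corootForm_weylAct (w : P.weylGroup) (i : ι) (v : ℂ ⊗[ℝ] V₀) :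
    corootForm P (w • i) (weylAct w v) = corootForm P i v := by
  induction v using TensorProduct.induction_on with
  | zero => simp
  | tmul c x =>
    simp only [weylAct, corootForm, LinearMap.baseChange_tmul,
      Module.Dual.baseChange_apply_tmul]
    congr 1
    exact coroot'_smul w i x
  | add x y hx hy => simp only [map_add, hx, hy]

theorem corootForm_negIdx (i : ι) (v : ℂ ⊗[ℝ] V₀) :
    corootForm P (negIdx P i) v = -corootForm P i v := by
  induction v using TensorProduct.induction_on with
  | zero => simp
  | tmul c x =>
    simp [corootForm, negIdx, Module.Dual.baseChange_apply_tmul, RootPairing.coroot']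
  | add x y hx hy => simp only [map_add, hx, hy, neg_add]

end Algebra

section Theta

variable {ι V₀ N : Type u} [AddCommGroup V₀] [Module ℝ V₀] [AddCommGroup N] [Module ℝ N]
  {P : RootPairing ι ℝ V₀ N} [Finite ι] [P.IsCrystallographic] [P.IsReduced]
  (b : P.Base) (k : ParameterFunction b)

theorem conj_simpleReflection (i : b.support) :
    longestElement b * simpleReflection b i * (longestElement b)⁻¹ =
      simpleReflection b (thetaSimple b i) := by
  change _ * RootPairing.weylGroup.ofIdx P i * _ =
    RootPairing.weylGroup.ofIdx P (negIdx P (longestElement b • (i : ι)))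
  rw [conj_ofIdx, ofIdx_negIdx]

theorem ParameterFunction.thetaSimple_eq (i : b.support) :
    k.toFun (thetaSimple b i) = k.toFun i := by
  symm
  apply k.invariant
  refine ⟨simpleReflection b (thetaSimple b i) * longestElement b, ?_⟩
  have h : longestElement b • P.root i = -P.root (thetaSimple b i) := by
    change _ = -P.root (negIdx P (longestElement b • (i : ι)))
    rw [root_negIdx, neg_neg, root_smul]
  rw [mul_smul, h, smul_neg]
  change -(P.reflection _ _) = _
  simp

/-- The endomorphism `θ` of `ℍ` as an algebra homomorphism:
`θ(v) = -w₀(v)` and `θ(t_w) = t_{w₀ w w₀⁻¹}`. -/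
def thetaHom : HeckeAlgebra b k →ₐ[ℂ] HeckeAlgebra b k :=
  HeckeAlgebra.lift
    (fun w ↦ HeckeAlgebra.t b k (longestElement b * w * (longestElement b)⁻¹))
    (fun v ↦ HeckeAlgebra.f b k (-weylAct (longestElement b) v))
    (by simp [HeckeAlgebra.t_one])
    (fun w w' ↦ by rw [← HeckeAlgebra.t_mul]; congr 1; group)
    (fun v v' ↦ by rw [← HeckeAlgebra.f_add, map_add, neg_add])
    (fun c v ↦ by rw [← HeckeAlgebra.f_smul, map_smul, smul_neg])
    (fun v v' ↦ HeckeAlgebra.f_comm _ _)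
    (fun i v ↦ by
      have h := HeckeAlgebra.t_mul_f (k := k) (thetaSimple b i)
        (-weylAct (longestElement b) v)
      rw [conj_simpleReflection]
      have h1 : weylAct (simpleReflection b (thetaSimple b i)) (weylAct (longestElement b) v) =
          weylAct (longestElement b) (weylAct (simpleReflection b i) v) := by
        rw [← weylAct_mul, ← weylAct_mul, ← conj_simpleReflection, inv_mul_cancel_right]
      have h2 : corootForm P (thetaSimple b i) (-weylAct (longestElement b) v) =
          corootForm P i v := by
        change corootForm P (negIdx P (longestElement b • (i : ι))) _ = _
        rw [corootForm_negIdx, map_neg, neg_neg, corootForm_weylAct]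
      rw [map_neg, h1, h2, k.thetaSimple_eq] at h
      exact h)

theorem thetaHom_t (w : P.weylGroup) : thetaHom b k (HeckeAlgebra.t b k w) =
    HeckeAlgebra.t b k (longestElement b * w * (longestElement b)⁻¹) :=
  HeckeAlgebra.lift_t _ _ _ _ _ _ _ _ w

theorem thetaHom_f (v : ℂ ⊗[ℝ] V₀) : thetaHom b k (HeckeAlgebra.f b k v) =
    HeckeAlgebra.f b k (-weylAct (longestElement b) v) :=
  HeckeAlgebra.lift_f _ _ _ _ _ _ _ _ v

theorem thetaHom_comp_self : (thetaHom b k).comp (thetaHom b k) = AlgHom.id ℂ _ := by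
  apply HeckeAlgebra.algHom_ext
  · intro w
    simp only [AlgHom.comp_apply, thetaHom_t, AlgHom.id_apply]
    congr 1
    rw [longestElement_inv]
    calc _ = (longestElement b * longestElement b) * w * (longestElement b * longestElement b) := by
          simp only [mul_assoc]
      _ = w := by rw [longestElement_mul_self, one_mul, mul_one]
  · intro v
    simp only [AlgHom.comp_apply, thetaHom_f, AlgHom.id_apply, map_neg, neg_neg]
    rw [← weylAct_mul, longestElement_mul_self, weylAct_one]

/-- The involution `θ` of `ℍ`: `θ(v) = -w₀(v)` and `θ(t_w) = t_{w₀ w w₀⁻¹}`. -/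
def theta : HeckeAlgebra b k ≃ₐ[ℂ] HeckeAlgebra b k :=
  AlgEquiv.ofAlgHom (thetaHom b k) (thetaHom b k) (thetaHom_comp_self b k) (thetaHom_comp_self b k)

theorem theta_theta (h : HeckeAlgebra b k) : theta b k (theta b k h) = h :=
  AlgHom.congr_fun (thetaHom_comp_self b k) h

theorem theta_sq : theta b k ^ 2 = 1 := by
  ext h
  rw [pow_two]
  exact theta_theta b k h

/-- The cyclic group `⟨θ⟩` of order two. -/
abbrev ThetaGroup : Type := Multiplicative (ZMod 2)

/-- The generator `θ` of `⟨θ⟩`. -/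
def thetaGen : ThetaGroup := Multiplicative.ofAdd 1

/-- The action of `⟨θ⟩` on `ℍ` by algebra automorphisms, the generator acting by `θ`. -/
def thetaAction : ThetaGroup →* (HeckeAlgebra b k ≃ₐ[ℂ] HeckeAlgebra b k) where
  toFun g := theta b k ^ (Multiplicative.toAdd g).val
  map_one' := by simp
  map_mul' g h := by
    rw [toAdd_mul, ZMod.val_add, ← pow_add]
    exact (pow_eq_pow_mod _ (theta_sq b k)).symm

instance : MulSemiringAction ThetaGroup (HeckeAlgebra b k) :=
  MulSemiringAction.compHom (HeckeAlgebra b k) (thetaAction b k)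

theorem thetaGen_smul (h : HeckeAlgebra b k) : thetaGen • h = theta b k h := by
  change (theta b k ^ (1 : ZMod 2).val) h = _
  rw [ZMod.val_one, pow_one]

instance : SMulCommClass ThetaGroup ℂ (HeckeAlgebra b k) where
  smul_comm g c h := map_smul (thetaAction b k g) c h

/-- The algebra `ℍ ⋊ ⟨θ⟩`: the skew group algebra of `⟨θ⟩` over `ℍ`, with multiplication
determined by `θ h = θ(h) θ`. -/
abbrev ExtendedHecke : Type u := SkewMonoidAlgebra (HeckeAlgebra b k) ThetaGroup

/-- The inclusion `ℍ → ℍ ⋊ ⟨θ⟩`. -/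
def incl : HeckeAlgebra b k →ₐ[ℂ] ExtendedHecke b k where
  __ := SkewMonoidAlgebra.singleOneRingHom
  commutes' _ := rfl

/-- The element `θ` of `ℍ ⋊ ⟨θ⟩`. -/
def thetaElt : ExtendedHecke b k := SkewMonoidAlgebra.single thetaGen 1

theorem thetaElt_mul_incl (h : HeckeAlgebra b k) :
    thetaElt b k * incl b k h = incl b k (theta b k h) * thetaElt b k := by
  change SkewMonoidAlgebra.single thetaGen 1 * SkewMonoidAlgebra.single 1 h =
    SkewMonoidAlgebra.single 1 (theta b k h) * SkewMonoidAlgebra.single thetaGen 1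
  rw [SkewMonoidAlgebra.single_mul_single, SkewMonoidAlgebra.single_mul_single,
    thetaGen_smul, one_smul, mul_one, one_mul, mul_one, one_mul]

theorem thetaElt_mul_self : thetaElt b k * thetaElt b k = 1 := by
  change SkewMonoidAlgebra.single thetaGen 1 * SkewMonoidAlgebra.single thetaGen 1 = _
  rw [SkewMonoidAlgebra.single_mul_single, smul_one, mul_one]
  rfl

/-- Restriction of `ℍ ⋊ ⟨θ⟩`-modules to `ℍ`-modules. -/
abbrev res : ModuleCat.{u} (ExtendedHecke b k) ⥤ ModuleCat.{u} (HeckeAlgebra b k) :=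
  ModuleCat.restrictScalars (incl b k).toRingHom

/-- The twist `X ↦ X^θ` of `ℍ`-modules: `X^θ` has the same underlying space, and `h` acts on
`X^θ` as `θ(h)` acts on `X`. -/
abbrev twist : ModuleCat.{u} (HeckeAlgebra b k) ⥤ ModuleCat.{u} (HeckeAlgebra b k) :=
  ModuleCat.restrictScalars (theta b k).toAlgHom.toRingHom

theorem restrictScalars_map_exact {R S : Type u} [Ring R] [Ring S] (φ : R →+* S)
    (C : ShortComplex (ModuleCat.{u} S)) (h : C.Exact) :
    (C.map (ModuleCat.restrictScalars.{u} φ)).Exact := by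
  rw [CategoryTheory.ShortComplex.ShortExact.moduleCat_exact_iff_function_exact] at h ⊢
  exact h

instance : Limits.PreservesFiniteLimits (twist b k) := by
  have h := ((Functor.exact_tfae (twist b k)).out 1 3).mp (restrictScalars_map_exact _)
  exact h.1

instance : Limits.PreservesFiniteColimits (twist b k) := by
  have h := ((Functor.exact_tfae (twist b k)).out 1 3).mp (restrictScalars_map_exact _)
  exact h.2

variable {b k}

/-- The action of `θ` on an `ℍ ⋊ ⟨θ⟩`-module `X`, as an `ℍ`-linear map `X → X^θ`. -/
def toTwist (X : ModuleCat.{u} (ExtendedHecke b k)) :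
    (res b k).obj X ⟶ (twist b k).obj ((res b k).obj X) :=
  ModuleCat.ofHom (X := (res b k).obj X) (Y := (twist b k).obj ((res b k).obj X))
    { toFun := fun (x : X) ↦ (thetaElt b k • x : X)
      map_add' := fun (x y : X) ↦ smul_add (thetaElt b k) x y
      map_smul' := fun h (x : X) ↦ by
        change thetaElt b k • incl b k h • x = incl b k (theta b k h) • thetaElt b k • x
        rw [← mul_smul, ← mul_smul, thetaElt_mul_incl] }

/-- The action of `θ` on an `ℍ ⋊ ⟨θ⟩`-module `X`, as an `ℍ`-linear map `X^θ → X`. -/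
def fromTwist (X : ModuleCat.{u} (ExtendedHecke b k)) :
    (twist b k).obj ((res b k).obj X) ⟶ (res b k).obj X :=
  ModuleCat.ofHom (X := (twist b k).obj ((res b k).obj X)) (Y := (res b k).obj X)
    { toFun := fun (x : X) ↦ (thetaElt b k • x : X)
      map_add' := fun (x y : X) ↦ smul_add (thetaElt b k) x y
      map_smul' := fun h (x : X) ↦ by
        change thetaElt b k • incl b k (theta b k h) • x = incl b k h • thetaElt b k • x
        rw [← mul_smul, ← mul_smul, thetaElt_mul_incl, theta_theta] }

/-- `Ext^i_ℍ(X, Y)` in the category of `ℍ`-modules, for `ℍ ⋊ ⟨θ⟩`-modules `X` and `Y`. -/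
abbrev ExtH (X Y : ModuleCat.{u} (ExtendedHecke b k)) (i : ℕ) : Type u :=
  Abelian.Ext ((res b k).obj X) ((res b k).obj Y) i

/-- `Ext^i` in the category of `ℍ ⋊ ⟨θ⟩`-modules. -/
abbrev ExtHTheta (X Y : ModuleCat.{u} (ExtendedHecke b k)) (i : ℕ) : Type u :=
  Abelian.Ext X Y i

/-- The natural map `θ^*` on `Ext^i_ℍ(X, Y)`: the composite
`Ext^i(X, Y) → Ext^i(X^θ, Y^θ) → Ext^i(X, Y)`, where the first map is induced by the exact functor
`M ↦ M^θ` and the second one by the actions `θ : X → X^θ` and `θ : Y^θ → Y`. On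
`Hom_ℍ(X, Y)`, and on cochains of an `ℍ ⋊ ⟨θ⟩`-equivariant resolution of `X`, it is
`ψ ↦ θ ∘ ψ ∘ θ`. -/
def thetaStar (X Y : ModuleCat.{u} (ExtendedHecke b k)) (i : ℕ) : ExtH X Y i →ₗ[ℂ] ExtH X Y i :=
  (Abelian.Ext.precompOfLinear (Abelian.Ext.mk₀ (toTwist X)) ℂ _ (zero_add i)) ∘ₗ
    (Abelian.Ext.postcompOfLinear (Abelian.Ext.mk₀ (fromTwist Y)) ℂ _ (add_zero i)) ∘ₗ
      (twist b k).mapExtLinearMap ℂ ((res b k).obj X) ((res b k).obj Y) i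

/-- The Euler-Poincaré pairing of `X` and `Y` regarded as `ℍ`-modules. -/
def EPH (X Y : ModuleCat.{u} (ExtendedHecke b k)) : ℤ :=
  ∑ᶠ i : ℕ, (-1) ^ i * (Module.finrank ℂ (ExtH X Y i) : ℤ)

/-- The Euler-Poincaré pairing of `X` and `Y` as `ℍ ⋊ ⟨θ⟩`-modules. -/
def EPHTheta (X Y : ModuleCat.{u} (ExtendedHecke b k)) : ℤ :=
  ∑ᶠ i : ℕ, (-1) ^ i * (Module.finrank ℂ (ExtHTheta X Y i) : ℤ)

/-- The `θ`-twisted Euler-Poincaré pairing of `X` and `Y`. -/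
def EPTwisted (X Y : ModuleCat.{u} (ExtendedHecke b k)) : ℂ :=
  ∑ᶠ i : ℕ, (-1) ^ i * LinearMap.trace ℂ (ExtH X Y i) (thetaStar X Y i)

end Theta

end GradedHecke

end

noncomputable section

namespace GradedHecke

/-! ### The group algebra element c(v) for which v - c(v) is permuted by W without error term -/

section Correction

variable {ι V₀ N : Type u} [AddCommGroup V₀] [Module ℝ V₀] [AddCommGroup N] [Module ℝ N]
  {P : RootPairing ι ℝ V₀ N}

/-! Two independent facts carry the theorem.

Invariants. Restriction identifies extensions over ℍ ⋊ ⟨θ⟩ with the θ*-invariant extensions over ℍ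
(`resExt_injective`, `range_resExt`). In degree zero this says that an ℍ-linear map is linear over
the larger algebra exactly when it commutes with θ. Since ℍ ⋊ ⟨θ⟩ is free over ℍ, a free cover over
the larger algebra stays projective over ℍ, and dimension shifting along such covers carries the
statement to all degrees; averaging with ½(1 + θ*) supplies the invariant classes needed at each
shift (`mapExactFunctor_injective_and_surjective`). As θ* is an involution (`thetaStar_thetaStar`),
½(1 + θ*) projects onto the invariants, and its trace is their dimension. This is the formula in
each degree.

Finiteness. Every ℍ-module M has a Koszul resolution with terms ℍ ⊗_{ℂ[W]} (⋀^i V ⊗ M). They are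
projective by Maschke averaging (`Ind.projective`) and vanish for i > dim V. An ℍ-map out of a term
is determined by its values on ⋀^i V ⊗ M, so Hom into a finite-dimensional module is
finite-dimensional when M is. Exactness is seen on the model S(V) ⊗ ⋀^i V ⊗ M: with the de Rham
differential as homotopy, the Laplacian acts on the pieces of the polynomial degree filtration by
nonzero scalars in positive homological degree (`koszulD_exact`); degree zero is direct
(`koszulAug_exact`). The model rests on the PBW theorem, ℍ = S(V) ⊗ ℂ[W] as a vector space, proved
by letting ℍ act from the right on S(V)[W] (`heckeToPBW_pbwToHecke`, `pbwToHecke_surjective`).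

The Ext groups over ℍ ⋊ ⟨θ⟩ embed in those over ℍ and inherit finiteness and vanishing, and the
Euler-Poincaré identity is the alternating sum of the degreewise formula. -/

theorem negIdx_negIdx (i : ι) : negIdx P (negIdx P i) = i := by
  apply P.root.injective
  rw [root_negIdx, root_negIdx, neg_neg]

theorem simpleReflection_mul_self {b : P.Base} (i : b.support) :
    simpleReflection b i * simpleReflection b i = 1 := ofIdx_mul_self (P := P) (i : ι)

theorem weylAct_weylAct_simpleReflection {b : P.Base} (i : b.support) (v : ℂ ⊗[ℝ] V₀) :
    weylAct (simpleReflection b i) (weylAct (simpleReflection b i) v) = v := by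
  rw [← weylAct_mul, simpleReflection_mul_self, weylAct_one]

theorem weylAct_simpleReflection {b : P.Base} (i : b.support) (v : ℂ ⊗[ℝ] V₀) :
    weylAct (simpleReflection b i) v = v - corootForm P i v • (1 ⊗ₜ P.root i) := by
  induction v using TensorProduct.induction_on with
  | zero => simp
  | tmul c x =>
    have h : P.weylGroupRootRep (simpleReflection b i) x = P.reflection i x := rfl
    rw [weylAct, LinearMap.baseChange_tmul, h, RootPairing.reflection_apply, corootForm,
      Module.Dual.baseChange_apply_tmul, TensorProduct.tmul_sub, TensorProduct.tmul_smul,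
      TensorProduct.smul_tmul', TensorProduct.smul_tmul']
    simp
  | add x y hx hy => simp only [map_add, hx, hy, add_smul]; abel

theorem corootForm_weylAct_simpleReflection {b : P.Base} (i : b.support) (v : ℂ ⊗[ℝ] V₀) :
    corootForm P i (weylAct (simpleReflection b i) v) = -corootForm P i v := by
  have h := corootForm_weylAct (simpleReflection b i) (negIdx P i) v
  have h2 : simpleReflection b i • negIdx P (i : ι) = i := by
    rw [smul_negIdx]
    exact negIdx_negIdx _
  rw [h2, corootForm_negIdx] at h
  exact h

variable (b : P.Base) (k : ParameterFunction b)

open Classical in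
/-- The extension of a parameter function to all roots conjugate to a simple root. -/
def ParameterFunction.ext (i : ι) : ℝ :=
  if h : ∃ j : b.support, ∃ w : P.weylGroup, w • (j : ι) = i then k.toFun h.choose else 0

theorem ParameterFunction.ext_simple (i : b.support) : k.ext b i = k.toFun i := by
  have h : ∃ j : b.support, ∃ w : P.weylGroup, w • (j : ι) = i := ⟨i, 1, one_smul _ _⟩
  rw [ParameterFunction.ext, dif_pos h]
  obtain ⟨w, hw⟩ := h.choose_spec
  exact k.invariant _ _ ⟨w, by rw [← root_smul, hw]⟩

-- The value at a root depends only on the set of simple roots conjugate to it, and this set is the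
-- same for i and w • i. Equality of the two predicates forces the two choices to coincide.
open Classical in
theorem ParameterFunction.ext_smul (w : P.weylGroup) (i : ι) : k.ext b (w • i) = k.ext b i := by
  have h : (fun j : b.support ↦ ∃ w' : P.weylGroup, w' • (j : ι) = w • i) =
      fun j : b.support ↦ ∃ w' : P.weylGroup, w' • (j : ι) = i := by
    funext j
    refine propext ⟨?_, ?_⟩
    · rintro ⟨w', h⟩
      exact ⟨w⁻¹ * w', by rw [mul_smul, h, inv_smul_smul]⟩
    · rintro ⟨w', h⟩
      exact ⟨w * w', by rw [mul_smul, h]⟩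
  exact congrArg (fun p : b.support → Prop ↦ if h : ∃ j, p j then k.toFun h.choose else 0) h

open Classical in
/-- The sign of a root. -/
def rootSign (i : ι) : ℂ := if b.IsPos i then 1 else -1

theorem rootSign_negIdx [Finite ι] [P.IsCrystallographic] [P.IsReduced] (i : ι) :
    rootSign b (negIdx P i) = -rootSign b i := by
  unfold rootSign
  by_cases h : b.IsPos i
  · rw [if_neg, if_pos h]
    rw [isPos_negIdx_iff]
    exact not_not.2 h
  · rw [if_pos ((isPos_negIdx_iff b i).2 h), if_neg h, neg_neg]

theorem rootSign_simple [Finite ι] [P.IsCrystallographic] [P.IsReduced] (i : b.support) :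
    rootSign b i = 1 :=
  if_pos (RootPairing.Base.isPos_of_mem_support i.2)

/-- A simple reflection permutes the positive roots other than its own; for a negative root the same
fact is applied to the opposite root. -/
theorem rootSign_smul [Finite ι] [P.IsCrystallographic] [P.IsReduced] (i : b.support) (j : ι)
    (h1 : j ≠ i) (h2 : j ≠ negIdx P i) :
    rootSign b (simpleReflection b i • j) = rootSign b j := by
  have key : ∀ j : ι, j ≠ i → b.IsPos j → b.IsPos (simpleReflection b i • j) :=
    fun j h hj ↦ hj.reflectionPerm i.2 h
  by_cases hj : b.IsPos j
  · rw [rootSign, rootSign, if_pos hj, if_pos (key j h1 hj)]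
  · have h := key (negIdx P j) (fun h ↦ h2 (by rw [← h, negIdx_negIdx]))
      ((isPos_negIdx_iff b j).2 hj)
    rw [smul_negIdx, isPos_negIdx_iff] at h
    rw [rootSign, rootSign, if_neg hj, if_neg h]

variable [Finite ι] [P.IsCrystallographic] [P.IsReduced]

/-- The element `½ ∑_{β > 0} k_β ⟨v, β^∨⟩ s_β` of the group algebra of the Weyl group. -/
def correction : (ℂ ⊗[ℝ] V₀) →ₗ[ℂ] MonoidAlgebra ℂ P.weylGroup :=
  letI := Fintype.ofFinite ι
  ∑ i, (corootForm P i).smulRight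
    -- The sum runs over all roots. β and -β give the same term, since the sign and the coroot both
    -- change, so 1/4 here is the weight 1/2 over positive roots.
    (MonoidAlgebra.single (RootPairing.weylGroup.ofIdx P i) (1 / 4 * rootSign b i * k.ext b i))

/-- Thus c(v) satisfies the same cross relation as v, and v - c(v) satisfies it without error term.
After reindexing the first product by β ↦ sβ, the two products differ only in the signs of sβ and β.
These agree unless β = ±α, and each of these two roots contributes half of the scalar. -/
theorem correction_cross (i : b.support) (v : ℂ ⊗[ℝ] V₀) :
    MonoidAlgebra.single (simpleReflection b i) 1 * correction b k v -
      correction b k (weylAct (simpleReflection b i) v) *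
        MonoidAlgebra.single (simpleReflection b i) 1 =
      algebraMap ℂ _ ((k.toFun i : ℂ) * corootForm P i v) := by
  classical
  let := Fintype.ofFinite ι
  set s := simpleReflection b i with hs
  have e1 : MonoidAlgebra.single s (1 : ℂ) * correction b k v =
      ∑ j, MonoidAlgebra.single (RootPairing.weylGroup.ofIdx P j * s)
        (1 / 4 * rootSign b (s • j) * k.ext b j * corootForm P j (weylAct s v)) := by
    rw [correction, LinearMap.sum_apply, Finset.mul_sum]
    refine Fintype.sum_equiv (MulAction.toPerm s) _ _ fun j ↦ ?_
    rw [LinearMap.smulRight_apply, MonoidAlgebra.smul_single, MonoidAlgebra.single_mul_single,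
      MulAction.toPerm_apply, corootForm_weylAct, ParameterFunction.ext_smul, ← mul_smul,
      simpleReflection_mul_self, one_smul, ← conj_ofIdx, one_mul, inv_mul_cancel_right]
    congr 1
    simp only [smul_eq_mul]
    ring
  have e2 : correction b k (weylAct s v) * MonoidAlgebra.single s 1 =
      ∑ j, MonoidAlgebra.single (RootPairing.weylGroup.ofIdx P j * s)
        (1 / 4 * rootSign b j * k.ext b j * corootForm P j (weylAct s v)) := by
    rw [correction, LinearMap.sum_apply, Finset.sum_mul]
    refine Finset.sum_congr rfl fun j _ ↦ ?_
    rw [LinearMap.smulRight_apply, MonoidAlgebra.smul_single, MonoidAlgebra.single_mul_single]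
    congr 1
    simp only [smul_eq_mul]
    ring
  have hne : (i : ι) ≠ negIdx P i := by
    intro h
    have h1 := (isPos_negIdx_iff b (i : ι))
    rw [← h] at h1
    exact (iff_not_self h1)
  have hsi : s • (i : ι) = negIdx P i := rfl
  rw [e1, e2, ← Finset.sum_sub_distrib, Finset.sum_eq_add (i : ι) (negIdx P i) hne]
  · rw [smul_negIdx, hsi, negIdx_negIdx, rootSign_negIdx, rootSign_simple, ofIdx_negIdx,
      corootForm_negIdx, corootForm_weylAct_simpleReflection, ← hsi, ParameterFunction.ext_smul,
      ParameterFunction.ext_simple, ← MonoidAlgebra.single_sub, ← MonoidAlgebra.single_sub,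
      ← MonoidAlgebra.single_add, MonoidAlgebra.coe_algebraMap]
    have : RootPairing.weylGroup.ofIdx P (i : ι) * s = 1 := simpleReflection_mul_self i
    rw [this]
    simp only [Function.comp_apply, Algebra.algebraMap_self, RingHom.id_apply]
    congr 1
    ring
  · intro j _ hj
    rw [rootSign_smul b i j hj.1 hj.2, sub_self]
  · simp
  · simp

end Correction

/-! ### Induction over words in the simple reflections -/

section Words

variable {ι V₀ N : Type u} [AddCommGroup V₀] [Module ℝ V₀] [AddCommGroup N] [Module ℝ N]
  {P : RootPairing ι ℝ V₀ N} [Finite ι] [P.IsCrystallographic] [P.IsReduced] (b : P.Base)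

theorem weyl_induction_left {p : P.weylGroup → Prop} (one : p 1)
    (mul : ∀ (i : b.support) (w : P.weylGroup), p w → p (simpleReflection b i * w))
    (w : P.weylGroup) : p w := by
  obtain ⟨l, rfl⟩ := exists_word b w
  induction l with
  | nil => exact one
  | cons i l ih => exact mul i _ ih

theorem weyl_induction_right {p : P.weylGroup → Prop} (one : p 1)
    (mul : ∀ (w : P.weylGroup) (i : b.support), p w → p (w * simpleReflection b i))
    (w : P.weylGroup) : p w := by
  obtain ⟨l, rfl⟩ := exists_word b w
  induction l using List.reverseRecOn with
  | nil => exact one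
  | append_singleton l i ih =>
    rw [List.map_append, List.prod_append, List.map_singleton, List.prod_singleton]
    exact mul _ i ih

end Words

/-! ### The symmetric algebra in coordinates -/

section Sym

variable (V₀ : Type u) [AddCommGroup V₀] [Module ℝ V₀] [FiniteDimensional ℝ V₀]

/-- A basis of `V = ℂ ⊗ V₀`. -/
def complexBasis : Module.Basis (Fin (Module.finrank ℂ (ℂ ⊗[ℝ] V₀))) ℂ (ℂ ⊗[ℝ] V₀) :=
  Module.finBasis ℂ (ℂ ⊗[ℝ] V₀)

/-- The symmetric algebra `S(V)` in coordinates. -/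
abbrev Sym : Type := MvPolynomial (Fin (Module.finrank ℂ (ℂ ⊗[ℝ] V₀))) ℂ

/-- The inclusion `V → S(V)`. -/
def symι : (ℂ ⊗[ℝ] V₀) →ₗ[ℂ] Sym V₀ := (complexBasis V₀).constr ℂ MvPolynomial.X

theorem symι_basis (j) : symι V₀ (complexBasis V₀ j) = MvPolynomial.X j :=
  (complexBasis V₀).constr_basis ℂ _ j

end Sym

/-! ### The operators of the right regular representation on S(V)[W] -/

section PBW

variable {ι V₀ N : Type u} [AddCommGroup V₀] [Module ℝ V₀] [AddCommGroup N] [Module ℝ N]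
  {P : RootPairing ι ℝ V₀ N} (b : P.Base) (k : ParameterFunction b) [FiniteDimensional ℝ V₀]

/-- The map `v ↦ f_v`, as a linear map. -/
def HeckeAlgebra.fLin : (ℂ ⊗[ℝ] V₀) →ₗ[ℂ] HeckeAlgebra b k where
  toFun := HeckeAlgebra.f b k
  map_add' := HeckeAlgebra.f_add
  map_smul' := HeckeAlgebra.f_smul

open scoped IsMulCommutative in
/-- The algebra homomorphism `S(V) → ℍ`. -/
def symToHecke : Sym V₀ →ₐ[ℂ] HeckeAlgebra b k :=
  haveI : IsMulCommutative (Algebra.adjoin ℂ (Set.range (HeckeAlgebra.f b k))) :=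
    Algebra.isMulCommutative_adjoin ℂ (by
      rintro _ ⟨v, rfl⟩ _ ⟨v', rfl⟩
      exact HeckeAlgebra.f_comm v v')
  (Algebra.adjoin ℂ (Set.range (HeckeAlgebra.f b k))).val.comp
    (MvPolynomial.aeval fun j ↦ (⟨HeckeAlgebra.f b k (complexBasis V₀ j),
      Algebra.subset_adjoin ⟨_, rfl⟩⟩ : Algebra.adjoin ℂ (Set.range (HeckeAlgebra.f b k))))

theorem symToHecke_X (j) :
    symToHecke b k (MvPolynomial.X j) = HeckeAlgebra.f b k (complexBasis V₀ j) := by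
  simp [symToHecke]

theorem symToHecke_symι (v : ℂ ⊗[ℝ] V₀) : symToHecke b k (symι V₀ v) = HeckeAlgebra.f b k v := by
  have : (symToHecke b k).toLinearMap ∘ₗ symι V₀ = HeckeAlgebra.fLin b k := by
    refine (complexBasis V₀).ext fun j ↦ ?_
    simp only [LinearMap.comp_apply, symι_basis]
    exact symToHecke_X b k j
  exact LinearMap.congr_fun this v

variable [Finite ι] [P.IsCrystallographic] [P.IsReduced]

/-- The group algebra of the Weyl group over `S(V)`: the underlying space of the regular
representation of `ℍ`. -/
abbrev PBWSpace (P : RootPairing ι ℝ V₀ N) : Type u := MonoidAlgebra (Sym V₀) P.weylGroup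

/-- The inclusion `ℂ[W] → S(V)[W]`. -/
def groupToPBW (P : RootPairing ι ℝ V₀ N) : MonoidAlgebra ℂ P.weylGroup →ₐ[ℂ] PBWSpace P :=
  MonoidAlgebra.lift ℂ _ P.weylGroup (MonoidAlgebra.of (Sym V₀) P.weylGroup)

theorem groupToPBW_single_one (w : P.weylGroup) :
    groupToPBW P (MonoidAlgebra.single w 1) = MonoidAlgebra.single w 1 := by
  simp [groupToPBW]

/-- Right multiplication by `v ∈ V` in the regular representation. -/
def pbwF (v : ℂ ⊗[ℝ] V₀) : Module.End (Sym V₀) (PBWSpace P) :=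
  Finsupp.lsum (Sym V₀) (fun y : P.weylGroup ↦ LinearMap.toSpanSingleton (Sym V₀) (PBWSpace P)
    -- In ℍ one expects y (v - c(v)) = (yv - c(yv)) y, with c the correction; this is that equation
    -- solved for y v.
    (MonoidAlgebra.single y (symι V₀ (weylAct y v)) +
      (MonoidAlgebra.single y 1 * groupToPBW P (correction b k v) -
        groupToPBW P (correction b k (weylAct y v)) * MonoidAlgebra.single y 1)))
  ∘ₗ (MonoidAlgebra.coeffLinearEquiv (Sym V₀)).toLinearMap

/-- Right multiplication by `t_w` in the regular representation. -/
def pbwT (P : RootPairing ι ℝ V₀ N) (w : P.weylGroup) : Module.End (Sym V₀) (PBWSpace P) :=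
  LinearMap.mulRight (Sym V₀) (MonoidAlgebra.single w 1)

theorem pbwF_single (v : ℂ ⊗[ℝ] V₀) (y : P.weylGroup) :
    pbwF b k v (MonoidAlgebra.single y 1) =
      MonoidAlgebra.single y (symι V₀ (weylAct y v)) +
      (MonoidAlgebra.single y 1 * groupToPBW P (correction b k v) -
        groupToPBW P (correction b k (weylAct y v)) * MonoidAlgebra.single y 1) := by
  simp [pbwF]

theorem pbwF_one (v : ℂ ⊗[ℝ] V₀) (p : Sym V₀) :
    pbwF b k v (p • (1 : PBWSpace P)) = (p * symι V₀ v) • 1 := by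
  rw [map_smul, MonoidAlgebra.one_def, pbwF_single, weylAct_one, ← MonoidAlgebra.one_def, one_mul,
    mul_one, sub_self, add_zero, MonoidAlgebra.one_def]
  simp

theorem pbwT_apply (w : P.weylGroup) (x : PBWSpace P) :
    pbwT P w x = x * MonoidAlgebra.single w 1 := rfl

theorem pbw_end_ext {f g : Module.End (Sym V₀) (PBWSpace P)}
    (h : ∀ y, f (MonoidAlgebra.single y 1) = g (MonoidAlgebra.single y 1)) : f = g := by
  refine LinearMap.ext fun x ↦ ?_
  induction x using MonoidAlgebra.induction_on with
  | of m => exact h m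
  | add x y hx hy => rw [map_add, map_add, hx, hy]
  | smul r x hx => rw [map_smul, map_smul, hx]

/-- At a group element y, the polynomial parts and the terms c(ysv) ys of the two products cancel.
What remains is y (s c(v) - c(sv) s), known from `correction_cross`. -/
theorem pbw_cross (i : b.support) (v : ℂ ⊗[ℝ] V₀) :
    pbwF b k v * pbwT P (simpleReflection b i) -
      pbwT P (simpleReflection b i) * pbwF b k (weylAct (simpleReflection b i) v) =
        algebraMap ℂ _ ((k.toFun i : ℂ) * corootForm P i v) := by
  have hc := congrArg (groupToPBW P) (correction_cross b k i v)
  rw [map_sub, map_mul, map_mul, groupToPBW_single_one, AlgHom.commutes] at hc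
  refine pbw_end_ext fun y ↦ ?_
  rw [LinearMap.sub_apply, Module.End.mul_apply, Module.End.mul_apply, pbwT_apply,
    MonoidAlgebra.single_mul_single, one_mul, pbwF_single, pbwF_single, pbwT_apply, weylAct_mul,
    Module.algebraMap_end_apply, Algebra.smul_def, Algebra.commutes, ← hc]
  have h1 : MonoidAlgebra.single (y * simpleReflection b i) (1 : Sym V₀) =
    MonoidAlgebra.single y 1 * MonoidAlgebra.single (simpleReflection b i) 1 := by simp
  have key : ∀ {A : Type u} [Ring A] {J J' Y s C C' D : A}, J' * s = J →
      J + (Y * s * C - D * (Y * s)) - (J' + (Y * C' - D * Y)) * s = Y * (s * C - C' * s) := by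
    intro A _ J J' Y s C C' D h
    rw [← h]
    noncomm_ring
  rw [h1]
  exact key (by rw [MonoidAlgebra.single_mul_single, mul_one])

/-- A commutator identity forced by the cross relations. -/
theorem commutator_mul_of_cross {A : Type*} [Ring A] [Algebra ℂ A] {t x y x' y' a : A}
    {c d e : ℂ} (hx : x * t - t * x' = algebraMap ℂ A (e * c))
    (hy : y * t - t * y' = algebraMap ℂ A (e * d)) (hx' : x' = x - c • a) (hy' : y' = y - d • a) :
    (x * y - y * x) * t = t * (x' * y' - y' * x') := by
  rw [Algebra.algebraMap_eq_smul_one, sub_eq_iff_eq_add] at hx hy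
  -- Moving t to the left leaves ec (y' - y) + ed (x - x'). It vanishes because both differences are
  -- multiples of the same a, with coefficients c and d.
  have e1 : (x * y - y * x) * t = x * (y * t) - y * (x * t) := by noncomm_ring
  have e2 : x * (t * y') = (x * t) * y' := (mul_assoc _ _ _).symm
  have e3 : y * (t * x') = (y * t) * x' := (mul_assoc _ _ _).symm
  rw [e1, hy, hx, mul_add, mul_add, e2, e3, hx, hy, hx', hy']
  simp only [mul_sub, sub_mul, add_mul, smul_mul_assoc, mul_smul_comm, one_mul, mul_one,
    mul_assoc]
  module

/-- At 1 the operators are multiplications in the commutative ring S(V). The cross relation moves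
the commutator of u and v at ws to that of su and sv at w, so the induction on w must range over all
u and v at once. -/
theorem pbwF_comm (u v : ℂ ⊗[ℝ] V₀) :
    pbwF b k u * pbwF b k v = pbwF b k v * pbwF b k u := by
  have hlin : ∀ (c : ℂ) (u v : ℂ ⊗[ℝ] V₀), pbwF b k (u - c • v) = pbwF b k u - c • pbwF b k v := by
    intro c u v
    refine pbw_end_ext fun y ↦ ?_
    rw [LinearMap.sub_apply, LinearMap.smul_apply, pbwF_single, pbwF_single, pbwF_single]
    simp only [map_sub, map_smul, mul_sub, sub_mul, MonoidAlgebra.single_sub, smul_add, smul_sub,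
      mul_smul_comm, smul_mul_assoc, MonoidAlgebra.smul_single]
    abel
  suffices ∀ (y : P.weylGroup) u v,
      (pbwF b k u * pbwF b k v - pbwF b k v * pbwF b k u) (MonoidAlgebra.single y 1) = 0 from
    sub_eq_zero.1 (pbw_end_ext fun y ↦ this y u v)
  intro y
  induction y using weyl_induction_right b with
  | one =>
    intro u v
    have h1 : (MonoidAlgebra.single 1 1 : PBWSpace P) = (1 : Sym V₀) • 1 := by
      rw [one_smul]; rfl
    rw [LinearMap.sub_apply, Module.End.mul_apply, Module.End.mul_apply, h1]
    simp only [pbwF_one]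
    rw [mul_right_comm, sub_self]
  | mul w i ih =>
    intro u v
    have h2 : (MonoidAlgebra.single (w * simpleReflection b i) 1 : PBWSpace P) =
        pbwT P (simpleReflection b i) (MonoidAlgebra.single w 1) := by
      rw [pbwT_apply]; simp
    rw [h2, ← Module.End.mul_apply, commutator_mul_of_cross (pbw_cross b k i u)
      (pbw_cross b k i v) (a := pbwF b k (1 ⊗ₜ P.root i)) ?_ ?_, Module.End.mul_apply, ih, map_zero]
    · rw [weylAct_simpleReflection, hlin]
    · rw [weylAct_simpleReflection, hlin]

end PBW

/-! ### Checking statements on the generators of ℍ -/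

section Generators

variable {ι V₀ N : Type u} [AddCommGroup V₀] [Module ℝ V₀] [AddCommGroup N] [Module ℝ N]
  {P : RootPairing ι ℝ V₀ N} {b : P.Base} {k : ParameterFunction b}

theorem HeckeAlgebra.induction_on {p : HeckeAlgebra b k → Prop} (h : HeckeAlgebra b k)
    (scalar : ∀ c : ℂ, p (algebraMap ℂ _ c)) (t : ∀ w, p (HeckeAlgebra.t b k w))
    (f : ∀ v, p (HeckeAlgebra.f b k v)) (mul : ∀ x y, p x → p y → p (x * y))
    (add : ∀ x y, p x → p y → p (x + y)) : p h := by
  obtain ⟨x, rfl⟩ := RingQuot.mkAlgHom_surjective ℂ (Rel b k) h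
  induction x with
  | grade0 r =>
    rw [AlgHom.commutes]
    exact scalar r
  | grade1 x =>
    cases x with
    | t w => exact t w
    | f v => exact f v
  | mul x y hx hy =>
    rw [map_mul]
    exact mul _ _ hx hy
  | add x y hx hy =>
    rw [map_add]
    exact add _ _ hx hy

theorem HeckeAlgebra.t_mul_f' (i : b.support) (v : ℂ ⊗[ℝ] V₀) :
    t b k (simpleReflection b i) * f b k v =
      f b k (weylAct (simpleReflection b i) v) * t b k (simpleReflection b i) +
      ((k.toFun i : ℂ) * corootForm P i v) • 1 := by
  rw [← sub_eq_iff_eq_add', t_mul_f, Algebra.algebraMap_eq_smul_one]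

theorem HeckeAlgebra.t_smul_f_smul {M : Type*} [AddCommGroup M] [Module (HeckeAlgebra b k) M]
    [Module ℂ M] [IsScalarTower ℂ (HeckeAlgebra b k) M] (i : b.support) (v : ℂ ⊗[ℝ] V₀) (m : M) :
    t b k (simpleReflection b i) • f b k v • m =
      f b k (weylAct (simpleReflection b i) v) • t b k (simpleReflection b i) • m +
      ((k.toFun i : ℂ) * corootForm P i v) • m := by
  rw [← mul_smul, t_mul_f', add_smul, mul_smul, smul_assoc _ (1 : HeckeAlgebra b k), one_smul]

variable [Finite ι] [P.IsCrystallographic] [P.IsReduced]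

/-- A complex linear map commuting with `V` and the simple reflections is `ℍ`-linear. -/
def heckeLinear {M M' : Type*} [AddCommGroup M] [Module (HeckeAlgebra b k) M] [Module ℂ M]
    [IsScalarTower ℂ (HeckeAlgebra b k) M] [AddCommGroup M'] [Module (HeckeAlgebra b k) M']
    [Module ℂ M'] [IsScalarTower ℂ (HeckeAlgebra b k) M'] (g : M →ₗ[ℂ] M')
    (ht : ∀ (i : b.support) m, g (HeckeAlgebra.t b k (simpleReflection b i) • m) =
      HeckeAlgebra.t b k (simpleReflection b i) • g m)
    (hf : ∀ v m, g (HeckeAlgebra.f b k v • m) = HeckeAlgebra.f b k v • g m) :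
    M →ₗ[HeckeAlgebra b k] M' where
  toFun := g
  map_add' := map_add g
  map_smul' h m := by
    change g (h • m) = h • g m
    induction h using HeckeAlgebra.induction_on generalizing m with
    | scalar c => rw [algebraMap_smul, algebraMap_smul, map_smul]
    | t w =>
      induction w using weyl_induction_left b generalizing m with
      | one => rw [HeckeAlgebra.t_one, one_smul, one_smul]
      | mul i w ih => rw [HeckeAlgebra.t_mul, mul_smul, mul_smul, ht, ih]
    | f v => exact hf v m
    | mul x y hx hy => rw [mul_smul, mul_smul, hx, hy]
    | add x y hx hy => rw [add_smul, add_smul, map_add, hx, hy]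

end Generators

/-! ### The PBW theorem: ℍ is S(V) ⊗ ℂ[W] as a vector space -/

section PBW

variable {ι V₀ N : Type u} [AddCommGroup V₀] [Module ℝ V₀] [AddCommGroup N] [Module ℝ N]
  {P : RootPairing ι ℝ V₀ N} (b : P.Base) (k : ParameterFunction b) [FiniteDimensional ℝ V₀]
  [Finite ι] [P.IsCrystallographic] [P.IsReduced]

theorem pbwF_linear (c : ℂ) (u v : ℂ ⊗[ℝ] V₀) :
    pbwF b k (u + c • v) = pbwF b k u + c • pbwF b k v := by
  refine pbw_end_ext fun y ↦ ?_
  rw [LinearMap.add_apply, LinearMap.smul_apply, pbwF_single, pbwF_single, pbwF_single]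
  simp only [map_add, map_smul, mul_add, add_mul, MonoidAlgebra.single_add, smul_add, smul_sub,
    mul_smul_comm, smul_mul_assoc, MonoidAlgebra.smul_single]
  abel

/-- The right regular representation of `ℍ` on `S(V)[W]`. -/
def pbwRep : HeckeAlgebra b k →ₐ[ℂ] (Module.End (Sym V₀) (PBWSpace P))ᵐᵒᵖ :=
  HeckeAlgebra.lift (fun w ↦ MulOpposite.op (pbwT P w)) (fun v ↦ MulOpposite.op (pbwF b k v))
    (by
      rw [← MulOpposite.op_one]
      congr 1
      refine pbw_end_ext fun y ↦ ?_
      simp [pbwT_apply])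
    (fun w w' ↦ by
      rw [← MulOpposite.op_mul]
      congr 1
      refine pbw_end_ext fun y ↦ ?_
      simp [pbwT_apply, mul_assoc])
    (fun v v' ↦ by simpa using congrArg MulOpposite.op (pbwF_linear b k 1 v v'))
    (fun c v ↦ by
      have h0 : pbwF b k 0 = 0 := pbw_end_ext fun y ↦ by
        rw [pbwF_single]
        simp
      have h := pbwF_linear b k c 0 v
      rw [h0, zero_add, zero_add] at h
      rw [h, MulOpposite.op_smul])
    (fun v v' ↦ by rw [← MulOpposite.op_mul, ← MulOpposite.op_mul, pbwF_comm])
    (fun i v ↦ by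
      rw [← MulOpposite.op_mul, ← MulOpposite.op_mul, ← MulOpposite.op_sub, pbw_cross]
      rfl)

/-- The image of `1` under the right regular representation. -/
def heckeToPBW : HeckeAlgebra b k →ₗ[ℂ] PBWSpace P :=
  ((LinearMap.applyₗ (1 : PBWSpace P)).restrictScalars ℂ ∘ₗ
    (MulOpposite.opLinearEquiv ℂ).symm.toLinearMap) ∘ₗ (pbwRep b k).toLinearMap

theorem heckeToPBW_apply (h : HeckeAlgebra b k) : heckeToPBW b k h = (pbwRep b k h).unop 1 := rfl

theorem heckeToPBW_mul_t (h : HeckeAlgebra b k) (w : P.weylGroup) :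
    heckeToPBW b k (h * HeckeAlgebra.t b k w) =
      heckeToPBW b k h * MonoidAlgebra.single w 1 := by
  rw [heckeToPBW_apply, map_mul, MulOpposite.unop_mul, Module.End.mul_apply,
    ← heckeToPBW_apply, pbwRep, HeckeAlgebra.lift_t]
  rfl

theorem heckeToPBW_symToHecke (p : Sym V₀) : heckeToPBW b k (symToHecke b k p) = p • 1 := by
  induction p using MvPolynomial.induction_on with
  | C a =>
    have : (MvPolynomial.C a : Sym V₀) = algebraMap ℂ _ a := rfl
    rw [this, AlgHom.commutes, heckeToPBW_apply, AlgHom.commutes, algebraMap_smul]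
    rfl
  | add p q hp hq => rw [map_add, map_add, hp, hq, add_smul]
  | mul_X p j hp =>
    rw [heckeToPBW_apply] at hp
    rw [map_mul, symToHecke_X, heckeToPBW_apply, map_mul, MulOpposite.unop_mul,
      Module.End.mul_apply, hp, pbwRep, HeckeAlgebra.lift_f, MulOpposite.unop_op, pbwF_one,
      symι_basis]

/-- The multiplication map `S(V)[W] → ℍ`. -/
def pbwToHecke : PBWSpace P →ₗ[ℂ] HeckeAlgebra b k :=
  Finsupp.lsum ℂ (fun w ↦ LinearMap.mulRight ℂ (HeckeAlgebra.t b k w) ∘ₗ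
    (symToHecke b k).toLinearMap) ∘ₗ (MonoidAlgebra.coeffLinearEquiv ℂ).toLinearMap

theorem pbwToHecke_single (w : P.weylGroup) (p : Sym V₀) :
    pbwToHecke b k (MonoidAlgebra.single w p) = symToHecke b k p * HeckeAlgebra.t b k w := by
  simp [pbwToHecke]

/-- The independence half of PBW: the product p t_w, acting on 1 from the right, recovers p w. -/
theorem heckeToPBW_pbwToHecke (x : PBWSpace P) : heckeToPBW b k (pbwToHecke b k x) = x := by
  induction x using MonoidAlgebra.induction_linear with
  | zero => rw [map_zero, map_zero]
  | add x y hx hy => rw [map_add, map_add, hx, hy]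
  | single w p =>
    rw [pbwToHecke_single, heckeToPBW_mul_t, heckeToPBW_symToHecke]
    simp

/-- The spanning half of PBW: the range contains 1 and is stable under left multiplication by the
generators. For a simple reflection, the cross relation moves t_s past one variable at a time. -/
theorem pbwToHecke_surjective : Function.Surjective (pbwToHecke b k) := by
  have hF : ∀ v, ∀ x ∈ LinearMap.range (pbwToHecke b k),
      HeckeAlgebra.f b k v * x ∈ LinearMap.range (pbwToHecke b k) := by
    rintro v _ ⟨x, rfl⟩
    induction x using MonoidAlgebra.induction_linear with
    | zero => rw [map_zero, mul_zero]; exact zero_mem _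
    | add x y hx hy => rw [map_add, mul_add]; exact add_mem hx hy
    | single w p =>
      exact ⟨MonoidAlgebra.single w (symι V₀ v * p), by
        rw [pbwToHecke_single, pbwToHecke_single, map_mul, symToHecke_symι, mul_assoc]⟩
  have hT : ∀ i : b.support, ∀ x ∈ LinearMap.range (pbwToHecke b k),
      HeckeAlgebra.t b k (simpleReflection b i) * x ∈ LinearMap.range (pbwToHecke b k) := by
    rintro i _ ⟨x, rfl⟩
    induction x using MonoidAlgebra.induction_linear with
    | zero => rw [map_zero, mul_zero]; exact zero_mem _
    | add x y hx hy => rw [map_add, mul_add]; exact add_mem hx hy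
    | single w p =>
      rw [pbwToHecke_single]
      induction p using MvPolynomial.induction_on with
      | C a =>
        have : (MvPolynomial.C a : Sym V₀) = algebraMap ℂ _ a := rfl
        refine ⟨MonoidAlgebra.single (simpleReflection b i * w) (MvPolynomial.C a), ?_⟩
        rw [pbwToHecke_single, this, AlgHom.commutes, HeckeAlgebra.t_mul, ← mul_assoc, ← mul_assoc,
          Algebra.commutes]
      | add p q hp hq => rw [map_add, add_mul, mul_add]; exact add_mem hp hq
      | mul_X p j hp =>
        rw [mul_comm p, map_mul, symToHecke_X, mul_assoc, ← mul_assoc, HeckeAlgebra.t_mul_f',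
          add_mul, mul_assoc, smul_mul_assoc, one_mul]
        refine add_mem (hF _ _ hp) (Submodule.smul_mem _ _ ⟨MonoidAlgebra.single w p, ?_⟩)
        rw [pbwToHecke_single]
  suffices ∀ h, ∀ x ∈ LinearMap.range (pbwToHecke b k), h * x ∈ LinearMap.range (pbwToHecke b k) by
    intro h
    have h1 := this h 1 ⟨MonoidAlgebra.single 1 1, by
      rw [pbwToHecke_single, map_one, HeckeAlgebra.t_one, one_mul]⟩
    rwa [mul_one] at h1
  intro h
  induction h using HeckeAlgebra.induction_on with
  | scalar c =>
    intro x hx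
    rw [← Algebra.smul_def]
    exact Submodule.smul_mem _ c hx
  | t w =>
    induction w using weyl_induction_left b with
    | one => intro x hx; rwa [HeckeAlgebra.t_one, one_mul]
    | mul i w ih => intro x hx; rw [HeckeAlgebra.t_mul, mul_assoc]; exact hT _ _ (ih x hx)
  | f v => exact hF v
  | mul x y hx hy => intro z hz; rw [mul_assoc]; exact hx _ (hy _ hz)
  | add x y hx hy => intro z hz; rw [add_mul]; exact add_mem (hx _ hz) (hy _ hz)

end PBW

/-! ### Modules induced from the Weyl group, on the model S(V) ⊗ U -/

section Induced

variable {ι V₀ N : Type u} [AddCommGroup V₀] [Module ℝ V₀] [AddCommGroup N] [Module ℝ N]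
  {P : RootPairing ι ℝ V₀ N} (b : P.Base) (k : ParameterFunction b) [FiniteDimensional ℝ V₀]
  [Finite ι] [P.IsCrystallographic] [P.IsReduced]
  {U : Type u} [AddCommMonoid U] [Module ℂ U] (ρ : Representation ℂ P.weylGroup U)

/-- The map `S(V)[W] ⊗ U → S(V) ⊗ U`, `p w ⊗ u ↦ p ⊗ w u`. -/
def pbwCollapse : PBWSpace P →ₗ[ℂ] U →ₗ[ℂ] Sym V₀ ⊗[ℂ] U :=
  Finsupp.lsum ℂ (fun w ↦ LinearMap.lcomp ℂ _ (ρ w) ∘ₗ TensorProduct.mk ℂ (Sym V₀) U) ∘ₗ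
    (MonoidAlgebra.coeffLinearEquiv ℂ).toLinearMap

theorem pbwCollapse_single (w : P.weylGroup) (p : Sym V₀) (u : U) :
    pbwCollapse ρ (MonoidAlgebra.single w p) u = p ⊗ₜ ρ w u := by
  simp [pbwCollapse]

/-- The map `ℍ ⊗ U → S(V) ⊗ U`, `p t_w ⊗ u ↦ p ⊗ w u`. -/
def collapse : HeckeAlgebra b k ⊗[ℂ] U →ₗ[ℂ] Sym V₀ ⊗[ℂ] U :=
  TensorProduct.lift (pbwCollapse ρ ∘ₗ heckeToPBW b k)

theorem collapse_tmul (p : Sym V₀) (w : P.weylGroup) (u : U) :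
    collapse b k ρ ((symToHecke b k p * HeckeAlgebra.t b k w) ⊗ₜ u) = p ⊗ₜ ρ w u := by
  rw [collapse, TensorProduct.lift.tmul, LinearMap.comp_apply, ← pbwToHecke_single,
    heckeToPBW_pbwToHecke, pbwCollapse_single]

/-- The map is balanced over ℂ[W], so the model behaves as ℍ ⊗_{ℂ[W]} U. -/
theorem collapse_mul_t (h : HeckeAlgebra b k) (w : P.weylGroup) (u : U) :
    collapse b k ρ ((h * HeckeAlgebra.t b k w) ⊗ₜ u) = collapse b k ρ (h ⊗ₜ ρ w u) := by
  obtain ⟨x, rfl⟩ := pbwToHecke_surjective b k h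
  induction x using MonoidAlgebra.induction_linear with
  | zero => simp
  | add x y hx hy => simp only [map_add, add_mul, TensorProduct.add_tmul, hx, hy]
  | single y p =>
    rw [pbwToHecke_single, mul_assoc, ← HeckeAlgebra.t_mul, collapse_tmul, collapse_tmul, map_mul,
      Module.End.mul_apply]

/-- The action of `ℍ` on `S(V) ⊗ U`, as a linear map. -/
def indAct : HeckeAlgebra b k →ₗ[ℂ] Module.End ℂ (Sym V₀ ⊗[ℂ] U) :=
  (LinearMap.compRight ℂ (collapse b k ρ)) ∘ₗ
    (LinearMap.lcomp ℂ _ (LinearMap.rTensor U (symToHecke b k).toLinearMap)) ∘ₗ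
      (LinearMap.rTensorHom U) ∘ₗ (LinearMap.mul ℂ (HeckeAlgebra b k))

theorem indAct_apply (h : HeckeAlgebra b k) (p : Sym V₀) (u : U) :
    indAct b k ρ h (p ⊗ₜ u) = collapse b k ρ ((h * symToHecke b k p) ⊗ₜ u) := rfl

/-- By PBW it is enough to take h' = p t_y, and t_y can be absorbed into u because the collapse is
balanced. This compatibility with left multiplication makes the action on the model associative. -/
theorem indAct_collapse (h h' : HeckeAlgebra b k) (u : U) :
    indAct b k ρ h (collapse b k ρ (h' ⊗ₜ u)) = collapse b k ρ ((h * h') ⊗ₜ u) := by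
  obtain ⟨x, rfl⟩ := pbwToHecke_surjective b k h'
  induction x using MonoidAlgebra.induction_linear with
  | zero => simp
  | add x y hx hy => simp only [map_add, mul_add, TensorProduct.add_tmul, hx, hy]
  | single y p =>
    rw [pbwToHecke_single, collapse_tmul, indAct_apply, ← mul_assoc, collapse_mul_t]

/-- The action of `ℍ` on `S(V) ⊗ U`. -/
def indRep : HeckeAlgebra b k →ₐ[ℂ] Module.End ℂ (Sym V₀ ⊗[ℂ] U) :=
  AlgHom.ofLinearMap (indAct b k ρ)
    (by
      refine TensorProduct.ext' fun p u ↦ ?_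
      have h := collapse_tmul b k ρ p 1 u
      rw [HeckeAlgebra.t_one, mul_one, map_one] at h
      rw [indAct_apply, one_mul, h]
      rfl)
    (fun h h' ↦ by
      refine TensorProduct.ext' fun p u ↦ ?_
      rw [Module.End.mul_apply, indAct_apply, indAct_apply, indAct_collapse, mul_assoc])

/-- The induced module `ℍ ⊗_{ℂ[W]} U`, realized on `S(V) ⊗ U`. -/
def Ind (_b : P.Base) (_k : ParameterFunction _b) (_ρ : Representation ℂ P.weylGroup U) : Type u :=
  Sym V₀ ⊗[ℂ] U

instance : AddCommGroup (Ind b k ρ) := inferInstanceAs (AddCommGroup (Sym V₀ ⊗[ℂ] U))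

instance : Module ℂ (Ind b k ρ) := inferInstanceAs (Module ℂ (Sym V₀ ⊗[ℂ] U))

instance : Module (HeckeAlgebra b k) (Ind b k ρ) :=
  Module.compHom (Sym V₀ ⊗[ℂ] U) (indRep b k ρ).toRingHom

instance : IsScalarTower ℂ (HeckeAlgebra b k) (Ind b k ρ) where
  smul_assoc c h x := LinearMap.congr_fun (map_smul (indRep b k ρ) c h) x

/-- The pure tensors in the induced module. -/
def Ind.tmul : Sym V₀ →ₗ[ℂ] U →ₗ[ℂ] Ind b k ρ := TensorProduct.mk ℂ (Sym V₀) U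

variable {b k ρ}

theorem Ind.induction_on {p : Ind b k ρ → Prop} (x : Ind b k ρ)
    (tmul : ∀ q u, p (Ind.tmul b k ρ q u)) (add : ∀ x y, p x → p y → p (x + y)) : p x := by
  refine TensorProduct.induction_on x ?_ tmul add
  have := tmul 0 0
  rwa [map_zero] at this

theorem Ind.t_smul (w : P.weylGroup) (u : U) :
    HeckeAlgebra.t b k w • Ind.tmul b k ρ 1 u = Ind.tmul b k ρ 1 (ρ w u) := by
  have h := collapse_tmul b k ρ 1 w u
  rw [map_one, one_mul] at h
  change indAct b k ρ _ (1 ⊗ₜ u) = _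
  rw [indAct_apply, map_one, mul_one, h]
  rfl

theorem Ind.sym_smul (q p : Sym V₀) (u : U) :
    symToHecke b k q • Ind.tmul b k ρ p u = Ind.tmul b k ρ (q * p) u := by
  have h := collapse_tmul b k ρ (q * p) 1 u
  rw [HeckeAlgebra.t_one, mul_one, map_one, map_mul] at h
  change indAct b k ρ _ (p ⊗ₜ u) = _
  rw [indAct_apply, h]
  rfl

theorem Ind.f_smul (v : ℂ ⊗[ℝ] V₀) (p : Sym V₀) (u : U) :
    HeckeAlgebra.f b k v • Ind.tmul b k ρ p u = Ind.tmul b k ρ (symι V₀ v * p) u := by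
  rw [← symToHecke_symι, Ind.sym_smul]

theorem Ind.tmul_eq_smul (p : Sym V₀) (u : U) :
    Ind.tmul b k ρ p u = symToHecke b k p • Ind.tmul b k ρ 1 u := by
  rw [Ind.sym_smul, mul_one]

theorem Ind.hom_ext {M : Type*} [AddCommGroup M] [Module (HeckeAlgebra b k) M]
    {g g' : Ind b k ρ →ₗ[HeckeAlgebra b k] M}
    (h : ∀ u, g (Ind.tmul b k ρ 1 u) = g' (Ind.tmul b k ρ 1 u)) : g = g' := by
  refine LinearMap.ext fun x ↦ ?_
  induction x using Ind.induction_on with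
  | tmul q u => rw [Ind.tmul_eq_smul, map_smul, map_smul, h]
  | add x y hx hy => rw [map_add, map_add, hx, hy]

variable {M : Type*} [AddCommGroup M] [Module (HeckeAlgebra b k) M] [Module ℂ M]
  [IsScalarTower ℂ (HeckeAlgebra b k) M]

/-- The linear map `p ⊗ u ↦ p g(u)`. -/
def Ind.liftLin (g : U →ₗ[ℂ] M) : Ind b k ρ →ₗ[ℂ] M :=
  TensorProduct.lift (((LinearMap.lcomp ℂ M g) ∘ₗ
    (Algebra.lsmul ℂ ℂ M : HeckeAlgebra b k →ₐ[ℂ] _).toLinearMap) ∘ₗ (symToHecke b k).toLinearMap)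

theorem Ind.liftLin_tmul (g : U →ₗ[ℂ] M) (p : Sym V₀) (u : U) :
    Ind.liftLin (ρ := ρ) g (Ind.tmul b k ρ p u) = symToHecke b k p • g u := rfl

/-- The universal property of the induced module. -/
def Ind.lift (g : U →ₗ[ℂ] M) (hg : ∀ (i : b.support) u, g (ρ (simpleReflection b i) u) =
    HeckeAlgebra.t b k (simpleReflection b i) • g u) : Ind b k ρ →ₗ[HeckeAlgebra b k] M :=
  haveI hf : ∀ v m, Ind.liftLin (ρ := ρ) g (HeckeAlgebra.f b k v • m) =
      HeckeAlgebra.f b k v • Ind.liftLin (ρ := ρ) g m := by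
    intro v m
    induction m using Ind.induction_on with
    | tmul q u =>
      rw [Ind.f_smul, Ind.liftLin_tmul, Ind.liftLin_tmul, map_mul, symToHecke_symι, mul_smul]
    | add x y hx hy => rw [smul_add, map_add, map_add, smul_add, hx, hy]
  heckeLinear (Ind.liftLin g) (by
    intro i m
    induction m using Ind.induction_on with
    | tmul q u =>
      -- Source and target obey the same cross relation, so compatibility with t_s passes from p to
      -- x_j p; constants are covered by the hypothesis on U.
      induction q using MvPolynomial.induction_on with
      | C a =>
        have : (MvPolynomial.C a : Sym V₀) = a • 1 := by rw [MvPolynomial.smul_eq_C_mul, mul_one]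
        rw [this, (Ind.tmul b k ρ).map_smul, LinearMap.smul_apply, smul_comm,
          (Ind.liftLin g).map_smul, (Ind.liftLin g).map_smul, smul_comm _ a, Ind.t_smul,
          Ind.liftLin_tmul, Ind.liftLin_tmul, map_one, one_smul, one_smul, hg]
      | add p q hp hq => simp only [map_add, LinearMap.add_apply, smul_add, hp, hq]
      | mul_X p j hp =>
        rw [mul_comm, ← symι_basis, ← Ind.f_smul, HeckeAlgebra.t_smul_f_smul, map_add, hf, hf, hp,
          HeckeAlgebra.t_smul_f_smul, (Ind.liftLin g).map_smul]
    | add x y hx hy => rw [smul_add, map_add, map_add, smul_add, hx, hy]) hf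

theorem Ind.lift_tmul (g : U →ₗ[ℂ] M) (hg) (p : Sym V₀) (u : U) :
    Ind.lift (ρ := ρ) g hg (Ind.tmul b k ρ p u) = symToHecke b k p • g u := rfl

end Induced

/-! ### Projectivity of induced modules -/

section Projective

variable {ι V₀ N : Type u} [AddCommGroup V₀] [Module ℝ V₀] [AddCommGroup N] [Module ℝ N]
  {P : RootPairing ι ℝ V₀ N} (b : P.Base) (k : ParameterFunction b) [FiniteDimensional ℝ V₀]
  [Finite ι] [P.IsCrystallographic] [P.IsReduced]
  {U : Type u} [AddCommMonoid U] [Module ℂ U] (ρ : Representation ℂ P.weylGroup U)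

/-- A module over `ℍ` as a representation of the Weyl group. -/
def resRep (M : Type*) [AddCommGroup M] [Module (HeckeAlgebra b k) M] [Module ℂ M]
    [IsScalarTower ℂ (HeckeAlgebra b k) M] : Representation ℂ P.weylGroup M where
  toFun w := Algebra.lsmul ℂ ℂ M (HeckeAlgebra.t b k w)
  map_one' := by rw [HeckeAlgebra.t_one, map_one]
  map_mul' w w' := by rw [HeckeAlgebra.t_mul, map_mul]

theorem resRep_apply {M : Type*} [AddCommGroup M] [Module (HeckeAlgebra b k) M] [Module ℂ M]
    [IsScalarTower ℂ (HeckeAlgebra b k) M] (w : P.weylGroup) (m : M) :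
    resRep b k M w m = HeckeAlgebra.t b k w • m := rfl

/-- Maschke's argument: a ℂ-linear section of the canonical free cover, restricted to 1 ⊗ U and
averaged over the finite group W, becomes W-equivariant. The universal property extends it to an
ℍ-linear section. -/
theorem Ind.projective : Module.Projective (HeckeAlgebra b k) (Ind b k ρ) := by
  refine Module.Projective.of_lifting_property'' fun f hf ↦ ?_
  have := Fintype.ofFinite P.weylGroup
  obtain ⟨r, hr⟩ := (f.restrictScalars ℂ).exists_rightInverse_of_surjective
    (LinearMap.range_eq_top.2 hf)
  let τ := resRep b k (Ind b k ρ →₀ HeckeAlgebra b k)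
  let g : U →ₗ[ℂ] (Ind b k ρ →₀ HeckeAlgebra b k) := (Fintype.card P.weylGroup : ℂ)⁻¹ •
    ∑ w, τ w ∘ₗ r ∘ₗ Ind.tmul b k ρ 1 ∘ₗ ρ w⁻¹
  have hg : ∀ (i : b.support) u, g (ρ (simpleReflection b i) u) =
      HeckeAlgebra.t b k (simpleReflection b i) • g u := by
    intro i u
    simp only [g, LinearMap.smul_apply, LinearMap.sum_apply, LinearMap.comp_apply]
    rw [smul_comm]
    congr 1
    rw [Finset.smul_sum]
    symm
    refine Fintype.sum_equiv (Equiv.mulLeft (simpleReflection b i)) _ _ fun w ↦ ?_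
    rw [Equiv.coe_mulLeft, ← resRep_apply, ← Module.End.mul_apply (τ _) (τ _), ← τ.map_mul,
      ← Module.End.mul_apply (ρ _) (ρ _), ← ρ.map_mul, mul_inv_rev, inv_mul_cancel_right]
  refine ⟨Ind.lift g hg, Ind.hom_ext fun u ↦ ?_⟩
  have hr' : ∀ x, f (r x) = x := fun x ↦ LinearMap.congr_fun hr x
  rw [LinearMap.comp_apply, Ind.lift_tmul, map_one, one_smul, LinearMap.id_apply]
  simp only [g, LinearMap.smul_apply, LinearMap.sum_apply, LinearMap.comp_apply]
  have h1 : ∀ w, f (τ w (r (Ind.tmul b k ρ 1 (ρ w⁻¹ u)))) = Ind.tmul b k ρ 1 u := by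
    intro w
    rw [resRep_apply, map_smul, hr', Ind.t_smul, ← Module.End.mul_apply, ← ρ.map_mul,
      mul_inv_cancel, ρ.map_one, Module.End.one_apply]
  rw [← LinearMap.restrictScalars_apply ℂ f, map_smul, map_sum]
  simp only [LinearMap.restrictScalars_apply, h1]
  rw [Finset.sum_const, Finset.card_univ, ← Nat.cast_smul_eq_nsmul ℂ, smul_smul,
    inv_mul_cancel₀ (Nat.cast_ne_zero.2 Fintype.card_ne_zero), one_smul]

end Projective

/-! ### Contraction, wedge and reflections on exterior powers -/

section Exterior

variable {V : Type u} [AddCommGroup V] [Module ℂ V]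

/-- Contraction with a linear form on the exterior algebra. -/
def extContract (ξ : Module.Dual ℂ V) : ExteriorAlgebra ℂ V →ₗ[ℂ] ExteriorAlgebra ℂ V :=
  CliffordAlgebra.contractLeft (Q := (0 : QuadraticForm ℂ V)) ξ

theorem extContract_ι_mul (ξ : Module.Dual ℂ V) (v : V) (x : ExteriorAlgebra ℂ V) :
    extContract ξ (ExteriorAlgebra.ι ℂ v * x) =
      ξ v • x - ExteriorAlgebra.ι ℂ v * extContract ξ x :=
  CliffordAlgebra.contractLeft_ι_mul _ _ _

theorem extContract_algebraMap (ξ : Module.Dual ℂ V) (c : ℂ) :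
    extContract ξ (algebraMap ℂ _ c) = 0 :=
  CliffordAlgebra.contractLeft_algebraMap _ _ _

theorem extContract_extContract (ξ : Module.Dual ℂ V) (x : ExteriorAlgebra ℂ V) :
    extContract ξ (extContract ξ x) = 0 :=
  CliffordAlgebra.contractLeft_contractLeft _ _

theorem extContract_comm (ξ η : Module.Dual ℂ V) (x : ExteriorAlgebra ℂ V) :
    extContract ξ (extContract η x) = -extContract η (extContract ξ x) :=
  CliffordAlgebra.contractLeft_comm _ _ _

theorem exterior_induction {p : ExteriorAlgebra ℂ V → Prop} (x : ExteriorAlgebra ℂ V)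
    (scalar : ∀ c : ℂ, p (algebraMap ℂ _ c)) (add : ∀ x y, p x → p y → p (x + y))
    (ι_mul : ∀ x v, p x → p (ExteriorAlgebra.ι ℂ v * x)) : p x :=
  CliffordAlgebra.left_induction (Q := (0 : QuadraticForm ℂ V)) scalar add ι_mul x

theorem exists_of_mem_exteriorPower_zero {x : ExteriorAlgebra ℂ V} (hx : x ∈ ⋀[ℂ]^0 V) :
    ∃ c : ℂ, algebraMap ℂ _ c = x :=
  Submodule.mem_one.1 hx

theorem exteriorPower_succ (i : ℕ) :
    ⋀[ℂ]^(i + 1) V = LinearMap.range (ExteriorAlgebra.ι ℂ (M := V)) * ⋀[ℂ]^i V :=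
  pow_succ' _ _

@[elab_as_elim]
theorem exteriorPower_succ_induction {i : ℕ} {p : ExteriorAlgebra ℂ V → Prop}
    {x : ExteriorAlgebra ℂ V} (hx : x ∈ ⋀[ℂ]^(i + 1) V)
    (mul : ∀ (v : V), ∀ y ∈ ⋀[ℂ]^i V, p (ExteriorAlgebra.ι ℂ v * y))
    (add : ∀ x y, p x → p y → p (x + y)) : p x := by
  rw [exteriorPower_succ] at hx
  refine Submodule.mul_induction_on hx ?_ add
  rintro _ ⟨v, rfl⟩ y hy
  exact mul v y hy

theorem ι_mul_mem_exteriorPower (v : V) {i : ℕ} {x : ExteriorAlgebra ℂ V} (hx : x ∈ ⋀[ℂ]^i V) :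
    ExteriorAlgebra.ι ℂ v * x ∈ ⋀[ℂ]^(i + 1) V := by
  rw [exteriorPower_succ]
  exact Submodule.mul_mem_mul ⟨v, rfl⟩ hx

theorem extContract_mem (ξ : Module.Dual ℂ V) (i : ℕ) {x : ExteriorAlgebra ℂ V}
    (hx : x ∈ ⋀[ℂ]^(i + 1) V) : extContract ξ x ∈ ⋀[ℂ]^i V := by
  induction i generalizing x with
  | zero =>
    refine exteriorPower_succ_induction hx (fun v y hy ↦ ?_) fun x y hx hy ↦ ?_
    · rw [extContract_ι_mul]
      obtain ⟨c, rfl⟩ := exists_of_mem_exteriorPower_zero hy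
      rw [extContract_algebraMap, mul_zero, sub_zero]
      exact Submodule.smul_mem _ _ hy
    · rw [map_add]
      exact add_mem hx hy
  | succ i ih =>
    refine exteriorPower_succ_induction hx (fun v y hy ↦ ?_) fun x y hx hy ↦ ?_
    · rw [extContract_ι_mul]
      exact sub_mem (Submodule.smul_mem _ _ hy) (ι_mul_mem_exteriorPower v (ih hy))
    · rw [map_add]
      exact add_mem hx hy

/-- Contraction with a linear form, on exterior powers. -/
def contr (ξ : Module.Dual ℂ V) (i : ℕ) : ⋀[ℂ]^(i + 1) V →ₗ[ℂ] ⋀[ℂ]^i V :=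
  (extContract ξ).restrict fun _ hx ↦ extContract_mem ξ i hx

/-- Multiplication by a vector, on exterior powers. -/
def wedge (v : V) (i : ℕ) : ⋀[ℂ]^i V →ₗ[ℂ] ⋀[ℂ]^(i + 1) V :=
  (LinearMap.mulLeft ℂ (ExteriorAlgebra.ι ℂ v)).restrict fun _ hx ↦
    ι_mul_mem_exteriorPower v hx

theorem coe_contr (ξ : Module.Dual ℂ V) (i : ℕ) (x : ⋀[ℂ]^(i + 1) V) :
    (contr ξ i x : ExteriorAlgebra ℂ V) =
      extContract ξ (x : ExteriorAlgebra ℂ V) := rfl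

theorem coe_wedge (v : V) (i : ℕ) (x : ⋀[ℂ]^i V) :
    (wedge v i x : ExteriorAlgebra ℂ V) = ExteriorAlgebra.ι ℂ v * x := rfl

theorem contr_wedge (ξ : Module.Dual ℂ V) (v : V) (i : ℕ) (x : ⋀[ℂ]^(i + 1) V) :
    contr ξ (i + 1) (wedge v (i + 1) x) = ξ v • x - wedge v i (contr ξ i x) :=
  Subtype.ext (extContract_ι_mul ξ v x)

theorem contr_wedge_zero (ξ : Module.Dual ℂ V) (v : V) (x : ⋀[ℂ]^0 V) :
    contr ξ 0 (wedge v 0 x) = ξ v • x := by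
  apply Subtype.ext
  refine (extContract_ι_mul ξ v x).trans ?_
  obtain ⟨x, hx⟩ := x
  obtain ⟨c, rfl⟩ := exists_of_mem_exteriorPower_zero hx
  rw [extContract_algebraMap, mul_zero, sub_zero]
  rfl

theorem contr_contr (ξ η : Module.Dual ℂ V) (i : ℕ) (x : ⋀[ℂ]^(i + 2) V) :
    contr ξ i (contr η (i + 1) x) = -contr η i (contr ξ (i + 1) x) :=
  Subtype.ext (extContract_comm ξ η x)

/-- Contraction, as a linear map in the linear form. -/
def contrLin (i : ℕ) (x : ⋀[ℂ]^(i + 1) V) : Module.Dual ℂ V →ₗ[ℂ] ⋀[ℂ]^i V where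
  toFun ξ := contr ξ i x
  map_add' ξ η := Subtype.ext (by
    simp only [coe_contr, extContract, map_add, LinearMap.add_apply, Submodule.coe_add])
  map_smul' c ξ := Subtype.ext (by
    simp only [coe_contr, extContract, map_smul, LinearMap.smul_apply, Submodule.coe_smul,
      RingHom.id_apply])

theorem sum_wedge_contr {J : Type*} [Fintype J] (e : Module.Basis J ℂ V) (i : ℕ)
    (x : ⋀[ℂ]^(i + 1) V) :
    ∑ j, wedge (e j) i (contr (e.coord j) i x) = ((i : ℂ) + 1) • x := by
  classical
  obtain ⟨x, hx⟩ := x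
  apply Subtype.ext
  rw [Submodule.coe_sum]
  simp only [coe_wedge, coe_contr, Submodule.coe_smul]
  -- The operator ∑ e_j ∧ ι(e_j^*) counts degree: each vector wedged on the left adds one copy of
  -- the product, since ∑ e_j^*(v) e_j = v.
  have key : ∀ (v : V) (y : ExteriorAlgebra ℂ V), ∑ j, ExteriorAlgebra.ι ℂ (e j) *
      extContract (e.coord j)
        (ExteriorAlgebra.ι ℂ v * y) = ExteriorAlgebra.ι ℂ v * y + ExteriorAlgebra.ι ℂ v *
        ∑ j, ExteriorAlgebra.ι ℂ (e j) *
          extContract (e.coord j) y := by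
    intro v y
    have h1 : ∀ j, ExteriorAlgebra.ι ℂ (e j) *
      extContract (e.coord j)
        (ExteriorAlgebra.ι ℂ v * y) = (e.coord j v • ExteriorAlgebra.ι ℂ (e j)) * y +
          ExteriorAlgebra.ι ℂ v * (ExteriorAlgebra.ι ℂ (e j) *
          extContract (e.coord j) y) := by
      intro j
      have h3 : ExteriorAlgebra.ι ℂ (e j) * ExteriorAlgebra.ι ℂ v =
          -(ExteriorAlgebra.ι ℂ v * ExteriorAlgebra.ι ℂ (e j)) :=
        eq_neg_of_add_eq_zero_left (ExteriorAlgebra.ι_add_mul_swap _ _)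
      rw [extContract_ι_mul, mul_sub, mul_smul_comm, smul_mul_assoc, ← mul_assoc, h3, neg_mul,
        sub_neg_eq_add, mul_assoc]
    simp only [h1]
    rw [Finset.sum_add_distrib, ← Finset.sum_mul, ← Finset.mul_sum]
    congr 2
    simp only [← map_smul]
    rw [← map_sum]
    congr 1
    exact e.sum_repr v
  induction i generalizing x with
  | zero =>
    refine exteriorPower_succ_induction hx (fun v y hy ↦ ?_) fun x y hx hy ↦ ?_
    · obtain ⟨c, rfl⟩ := exists_of_mem_exteriorPower_zero hy
      rw [key]
      simp only [extContract_algebraMap, mul_zero, Finset.sum_const_zero, add_zero]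
      simp
    · simp only [map_add, mul_add, Finset.sum_add_distrib, smul_add]
      rw [hx, hy]
  | succ i ih =>
    refine exteriorPower_succ_induction hx (fun v y hy ↦ ?_) fun x y hx hy ↦ ?_
    · rw [key, ih y hy, mul_smul_comm]
      push_cast
      module
    · simp only [map_add, mul_add, Finset.sum_add_distrib, smul_add]
      rw [hx, hy]

theorem coe_exteriorPower_map (f : V →ₗ[ℂ] V) (i : ℕ) (x : ⋀[ℂ]^i V) :
    (exteriorPower.map i f x : ExteriorAlgebra ℂ V) = ExteriorAlgebra.map f x := by
  have : (⋀[ℂ]^i V).subtype ∘ₗ exteriorPower.map i f =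
      (ExteriorAlgebra.map f).toLinearMap ∘ₗ (⋀[ℂ]^i V).subtype := by
    apply exteriorPower.linearMap_ext
    ext v
    simp [ExteriorAlgebra.ιMulti_apply, List.map_ofFn, map_list_prod, Function.comp_def]
  exact LinearMap.congr_fun this x

theorem map_contractLeft (f : V →ₗ[ℂ] V) (ξ : Module.Dual ℂ V) (x : ExteriorAlgebra ℂ V) :
    ExteriorAlgebra.map f (extContract (ξ ∘ₗ f) x) =
      extContract ξ (ExteriorAlgebra.map f x) := by
  induction x using exterior_induction with
  | scalar r =>
    rw [extContract_algebraMap, AlgHom.commutes, extContract_algebraMap, map_zero]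
  | add x y hx hy => simp only [map_add, hx, hy]
  | ι_mul x v hx =>
    rw [extContract_ι_mul, map_sub, map_smul, map_mul, map_mul, hx, ExteriorAlgebra.map_apply_ι,
      extContract_ι_mul]
    rfl

theorem map_contr (f : V →ₗ[ℂ] V) (ξ : Module.Dual ℂ V) (i : ℕ) (x : ⋀[ℂ]^(i + 1) V) :
    exteriorPower.map i f (contr (ξ ∘ₗ f) i x) = contr ξ i (exteriorPower.map (i + 1) f x) := by
  apply Subtype.ext
  rw [coe_exteriorPower_map, coe_contr, coe_contr, coe_exteriorPower_map, map_contractLeft]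

/-- Only one factor can be replaced by a multiple of a, because a ∧ a = 0; hence the map induced by
f is linear in the contraction. -/
theorem map_reflection (f : V →ₗ[ℂ] V) (ξ : Module.Dual ℂ V) (a : V)
    (hf : ∀ v, f v = v - ξ v • a) (x : ExteriorAlgebra ℂ V) :
    ExteriorAlgebra.map f x = x - ExteriorAlgebra.ι ℂ a *
      extContract ξ x := by
  induction x using exterior_induction with
  | scalar r =>
    rw [extContract_algebraMap, AlgHom.commutes, mul_zero, sub_zero]
  | add x y hx hy => simp only [map_add, hx, hy, mul_add]; abel
  | ι_mul x v hx =>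
    have h3 : ExteriorAlgebra.ι ℂ v * ExteriorAlgebra.ι ℂ a =
        -(ExteriorAlgebra.ι ℂ a * ExteriorAlgebra.ι ℂ v) :=
      eq_neg_of_add_eq_zero_left (ExteriorAlgebra.ι_add_mul_swap _ _)
    rw [map_mul, hx, ExteriorAlgebra.map_apply_ι, hf, extContract_ι_mul, map_sub, map_smul]
    simp only [mul_sub, sub_mul, smul_mul_assoc, mul_smul_comm, ← mul_assoc, h3,
      ExteriorAlgebra.ι_sq_zero, zero_mul, smul_zero, neg_mul]
    abel

/-- On ι_ξ x the correction a ∧ ι_ξ(·) vanishes, since ι_ξ squares to zero. This removes the error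
terms in the equivariance of the Koszul differential. -/
theorem map_contr_reflection (f : V →ₗ[ℂ] V) (ξ : Module.Dual ℂ V) (a : V)
    (hf : ∀ v, f v = v - ξ v • a) (i : ℕ) (x : ⋀[ℂ]^(i + 1) V) :
    exteriorPower.map i f (contr ξ i x) = contr ξ i x := by
  apply Subtype.ext
  rw [coe_exteriorPower_map, map_reflection f ξ a hf, coe_contr,
    extContract_extContract, mul_zero, sub_zero]

variable (V) in
/-- The exterior power of a complex vector space, as a type. -/
def ExtPow (i : ℕ) : Type u := ⋀[ℂ]^i V

namespace ExtPow

instance (i : ℕ) : AddCommGroup (ExtPow V i) := inferInstanceAs (AddCommGroup (⋀[ℂ]^i V))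

instance (i : ℕ) : Module ℂ (ExtPow V i) := inferInstanceAs (Module ℂ (⋀[ℂ]^i V))

instance [FiniteDimensional ℂ V] (i : ℕ) : FiniteDimensional ℂ (ExtPow V i) :=
  inferInstanceAs (FiniteDimensional ℂ (⋀[ℂ]^i V))

theorem subsingleton [FiniteDimensional ℂ V] {i : ℕ} (hi : Module.finrank ℂ V < i) :
    Subsingleton (ExtPow V i) := by
  have h : Module.finrank ℂ (⋀[ℂ]^i V) = 0 := by
    rw [exteriorPower.finrank_eq, Nat.choose_eq_zero_of_lt hi]
  have h' : Subsingleton (⋀[ℂ]^i V) := Module.finrank_zero_iff.1 h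
  exact h'

/-- Contraction with a linear form, bilinearly. -/
def contr (i : ℕ) (x : ExtPow V (i + 1)) : Module.Dual ℂ V →ₗ[ℂ] ExtPow V i := contrLin i x

/-- Contraction with a linear form. -/
def contrMap (ξ : Module.Dual ℂ V) (i : ℕ) : ExtPow V (i + 1) →ₗ[ℂ] ExtPow V i :=
  GradedHecke.contr ξ i

theorem contrMap_apply (ξ : Module.Dual ℂ V) (i : ℕ) (x : ExtPow V (i + 1)) :
    contrMap ξ i x = contr i x ξ := rfl

/-- Multiplication by a vector. -/
def wedge (v : V) (i : ℕ) : ExtPow V i →ₗ[ℂ] ExtPow V (i + 1) := GradedHecke.wedge v i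

/-- The map on exterior powers induced by a linear map. -/
def map (f : V →ₗ[ℂ] V) (i : ℕ) : ExtPow V i →ₗ[ℂ] ExtPow V i := exteriorPower.map i f

/-- The identification of the zeroth exterior power with the scalars. -/
def zeroEquiv : ExtPow V 0 ≃ₗ[ℂ] ℂ := exteriorPower.zeroEquiv ℂ V

theorem zeroEquiv_map (f : V →ₗ[ℂ] V) (x : ExtPow V 0) : zeroEquiv (map f 0 x) = zeroEquiv x :=
  LinearMap.congr_fun (exteriorPower.zeroEquiv_naturality f) x

theorem map_one (i : ℕ) : map (LinearMap.id : V →ₗ[ℂ] V) i = 1 :=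
  exteriorPower.map_id

theorem map_mul (f g : V →ₗ[ℂ] V) (i : ℕ) : map (f ∘ₗ g) i = map f i * map g i :=
  LinearMap.ext fun x ↦ LinearMap.congr_fun (exteriorPower.map_comp (n := i) g f) x

theorem contr_wedge (ξ : Module.Dual ℂ V) (v : V) (i : ℕ) (x : ExtPow V (i + 1)) :
    contr (i + 1) (wedge v (i + 1) x) ξ = ξ v • x - wedge v i (contr i x ξ) :=
  GradedHecke.contr_wedge ξ v i x

theorem contr_wedge_zero (ξ : Module.Dual ℂ V) (v : V) (x : ExtPow V 0) :
    contr 0 (wedge v 0 x) ξ = ξ v • x :=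
  GradedHecke.contr_wedge_zero ξ v x

theorem contr_contr (ξ η : Module.Dual ℂ V) (i : ℕ) (x : ExtPow V (i + 2)) :
    contr i (contr (i + 1) x η) ξ = -contr i (contr (i + 1) x ξ) η :=
  GradedHecke.contr_contr ξ η i x

theorem sum_wedge_contr {J : Type*} [Fintype J] (e : Module.Basis J ℂ V) (i : ℕ)
    (x : ExtPow V (i + 1)) : ∑ j, wedge (e j) i (contr i x (e.coord j)) = ((i : ℂ) + 1) • x :=
  GradedHecke.sum_wedge_contr e i x

theorem map_contr (f : V →ₗ[ℂ] V) (ξ : Module.Dual ℂ V) (i : ℕ) (x : ExtPow V (i + 1)) :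
    map f i (contr i x (ξ ∘ₗ f)) = contr i (map f (i + 1) x) ξ :=
  GradedHecke.map_contr f ξ i x

theorem map_contr_reflection (f : V →ₗ[ℂ] V) (ξ : Module.Dual ℂ V) (a : V)
    (hf : ∀ v, f v = v - ξ v • a) (i : ℕ) (x : ExtPow V (i + 1)) :
    map f i (contr i x ξ) = contr i x ξ :=
  GradedHecke.map_contr_reflection f ξ a hf i x

end ExtPow

end Exterior

/-- Both sides evaluate F on the tensor in V ⊗ V^* that represents A. -/
theorem sum_basis_coord_comp {V M J : Type*} [AddCommGroup V] [Module ℂ V] [AddCommGroup M]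
    [Module ℂ M] [Fintype J] (e : Module.Basis J ℂ V) (F : V →ₗ[ℂ] Module.Dual ℂ V →ₗ[ℂ] M)
    (A : V →ₗ[ℂ] V) : ∑ j, F (A (e j)) (e.coord j) = ∑ j, F (e j) (e.coord j ∘ₗ A) := by
  classical
  have h1 : ∀ j, F (A (e j)) (e.coord j) = ∑ l, e.coord l (A (e j)) • F (e l) (e.coord j) := by
    intro j
    conv_lhs => rw [← e.sum_repr (A (e j))]
    simp only [map_sum, map_smul, LinearMap.sum_apply, LinearMap.smul_apply]
    rfl
  have h2 : ∀ l, F (e l) (e.coord l ∘ₗ A) = ∑ j, e.coord l (A (e j)) • F (e l) (e.coord j) := by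
    intro l
    conv_lhs => rw [← e.sum_dual_apply_smul_coord (e.coord l ∘ₗ A)]
    simp only [map_sum, map_smul]
    rfl
  simp only [h1, h2]
  exact Finset.sum_comm

theorem sum_sum_eq_zero_of_antisymm {M J : Type*} [AddCommGroup M] [Module ℂ M] [Fintype J]
    (a : J → J → M) (h : ∀ i j, a j i = -a i j) : ∑ i, ∑ j, a i j = 0 := by
  have h1 : ∑ i, ∑ j, a i j = -∑ i, ∑ j, a i j := by
    conv_lhs => rw [Finset.sum_comm]
    simp only [← Finset.sum_neg_distrib]
    exact Finset.sum_congr rfl fun i _ ↦ Finset.sum_congr rfl fun j _ ↦ h i j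
  have h2 : (2 : ℂ) • ∑ i, ∑ j, a i j = 0 := by
    rw [two_smul]
    nth_rewrite 1 [h1]
    exact neg_add_cancel _
  exact (smul_eq_zero.1 h2).resolve_left two_ne_zero

/-! ### The Koszul complex of an ℍ-module and its homotopy -/

section Koszul

variable {ι V₀ N : Type u} [AddCommGroup V₀] [Module ℝ V₀] [AddCommGroup N] [Module ℝ N]
  {P : RootPairing ι ℝ V₀ N} (b : P.Base) (k : ParameterFunction b) [FiniteDimensional ℝ V₀]
  [Finite ι] [P.IsCrystallographic] [P.IsReduced]
  (M : Type u) [AddCommGroup M] [Module (HeckeAlgebra b k) M] [Module ℂ M]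
  [IsScalarTower ℂ (HeckeAlgebra b k) M]

/-- The Weyl group acting on the exterior powers of `V`. -/
def extRep (P : RootPairing ι ℝ V₀ N) (i : ℕ) :
    Representation ℂ P.weylGroup (ExtPow (ℂ ⊗[ℝ] V₀) i) where
  toFun w := ExtPow.map (weylAct w) i
  map_one' := by
    have : weylAct (1 : P.weylGroup) = LinearMap.id := LinearMap.ext weylAct_one
    rw [this, ExtPow.map_one]
  map_mul' w w' := by
    have : weylAct (w * w') = weylAct w ∘ₗ weylAct w' := LinearMap.ext (weylAct_mul w w')
    rw [this, ExtPow.map_mul]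

/-- The representation `⋀^i V ⊗ M` of the Weyl group. -/
def koszulRep (i : ℕ) : Representation ℂ P.weylGroup (ExtPow (ℂ ⊗[ℝ] V₀) i ⊗[ℂ] M) :=
  (extRep P i).tprod (resRep b k M)

theorem koszulRep_tmul (i : ℕ) (w : P.weylGroup) (ω : ExtPow (ℂ ⊗[ℝ] V₀) i) (m : M) :
    koszulRep b k M i w (ω ⊗ₜ m) =
      ExtPow.map (weylAct w) i ω ⊗ₜ (HeckeAlgebra.t b k w • m) := rfl

/-- The terms of the Koszul resolution. -/
abbrev Koszul (i : ℕ) : Type u := Ind b k (koszulRep b k M i)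

/-- The pure tensors in the Koszul resolution. -/
def kz (i : ℕ) : Sym V₀ →ₗ[ℂ] (ExtPow (ℂ ⊗[ℝ] V₀) i ⊗[ℂ] M) →ₗ[ℂ] Koszul b k M i :=
  Ind.tmul b k (koszulRep b k M i)

theorem f_smul_kz (i : ℕ) (v : ℂ ⊗[ℝ] V₀) (p : Sym V₀) (u : ExtPow (ℂ ⊗[ℝ] V₀) i ⊗[ℂ] M) :
    HeckeAlgebra.f b k v • kz b k M i p u = kz b k M i (symι V₀ v * p) u :=
  Ind.f_smul v p u

theorem sym_smul_kz (i : ℕ) (q p : Sym V₀) (u : ExtPow (ℂ ⊗[ℝ] V₀) i ⊗[ℂ] M) :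
    symToHecke b k q • kz b k M i p u = kz b k M i (q * p) u :=
  Ind.sym_smul q p u

theorem t_smul_kz (i : ℕ) (w : P.weylGroup) (ω : ExtPow (ℂ ⊗[ℝ] V₀) i) (m : M) :
    HeckeAlgebra.t b k w • kz b k M i 1 (ω ⊗ₜ m) =
      kz b k M i 1 (ExtPow.map (weylAct w) i ω ⊗ₜ (HeckeAlgebra.t b k w • m)) :=
  Ind.t_smul w (ω ⊗ₜ m)

/-- The map `v ↦ v m`. -/
def fAct (m : M) : (ℂ ⊗[ℝ] V₀) →ₗ[ℂ] M where
  toFun v := HeckeAlgebra.f b k v • m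
  map_add' v v' := by rw [HeckeAlgebra.f_add, add_smul]
  map_smul' c v := by rw [HeckeAlgebra.f_smul, smul_assoc]; rfl

/-- The action of `v` on `M`, as a complex linear map. -/
def fEnd (v : ℂ ⊗[ℝ] V₀) : M →ₗ[ℂ] M := Algebra.lsmul ℂ ℂ M (HeckeAlgebra.f b k v)

theorem fEnd_apply (v : ℂ ⊗[ℝ] V₀) (m : M) : fEnd b k M v m = HeckeAlgebra.f b k v • m := rfl

/-- The bilinear map whose trace is the Koszul differential on generators. -/
def koszulForm (i : ℕ) (ω : ExtPow (ℂ ⊗[ℝ] V₀) (i + 1)) (m : M) :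
    (ℂ ⊗[ℝ] V₀) →ₗ[ℂ] Module.Dual ℂ (ℂ ⊗[ℝ] V₀) →ₗ[ℂ] Koszul b k M i :=
  (kz b k M i ∘ₗ symι V₀).compl₂ ((TensorProduct.mk ℂ _ _).flip m ∘ₗ ExtPow.contr i ω) -
    (((TensorProduct.mk ℂ _ _).compl₁₂ (ExtPow.contr i ω) (fAct b k M m)).flip).compr₂
      (kz b k M i 1)

theorem koszulForm_apply (i : ℕ) (ω : ExtPow (ℂ ⊗[ℝ] V₀) (i + 1)) (m : M) (v : ℂ ⊗[ℝ] V₀)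
    (ξ : Module.Dual ℂ (ℂ ⊗[ℝ] V₀)) : koszulForm b k M i ω m v ξ =
      kz b k M i (symι V₀ v) (ExtPow.contr i ω ξ ⊗ₜ m) -
        kz b k M i 1 (ExtPow.contr i ω ξ ⊗ₜ (HeckeAlgebra.f b k v • m)) := rfl

/-- The Koszul differential on generators. -/
def koszulGen (i : ℕ) : (ExtPow (ℂ ⊗[ℝ] V₀) (i + 1) ⊗[ℂ] M) →ₗ[ℂ] Koszul b k M i :=
  ∑ j, (kz b k M i (symι V₀ (complexBasis V₀ j)) ∘ₗ
      LinearMap.rTensor M (ExtPow.contrMap ((complexBasis V₀).coord j) i) -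
    kz b k M i 1 ∘ₗ TensorProduct.map (ExtPow.contrMap ((complexBasis V₀).coord j) i)
      (fEnd b k M (complexBasis V₀ j)))

theorem koszulGen_tmul (i : ℕ) (ω : ExtPow (ℂ ⊗[ℝ] V₀) (i + 1)) (m : M) :
    koszulGen b k M i (ω ⊗ₜ m) =
      ∑ j, koszulForm b k M i ω m (complexBasis V₀ j) ((complexBasis V₀).coord j) := by
  simp only [koszulGen, LinearMap.sum_apply, LinearMap.sub_apply, LinearMap.comp_apply,
    LinearMap.rTensor_tmul, TensorProduct.map_tmul, koszulForm_apply, fEnd_apply,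
    ExtPow.contrMap_apply]

/-- The cross relation is used twice: for v acting on the induced module, with error on the
contraction of ω, and for v acting on M, with error on the reflected contraction. The two errors
enter with opposite signs. -/
theorem t_smul_koszulForm (i : ℕ) (s : b.support) (ω : ExtPow (ℂ ⊗[ℝ] V₀) (i + 1)) (m : M)
    (v : ℂ ⊗[ℝ] V₀) (ξ : Module.Dual ℂ (ℂ ⊗[ℝ] V₀)) :
    HeckeAlgebra.t b k (simpleReflection b s) • koszulForm b k M i ω m v ξ =
      koszulForm b k M i (ExtPow.map (weylAct (simpleReflection b s)) (i + 1) ω)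
        (HeckeAlgebra.t b k (simpleReflection b s) • m) (weylAct (simpleReflection b s) v)
        (ξ ∘ₗ weylAct (simpleReflection b s)) +
      ((k.toFun s : ℂ) * corootForm P s v) • kz b k M i 1
        ((ExtPow.contr i ω ξ -
          ExtPow.map (weylAct (simpleReflection b s)) i (ExtPow.contr i ω ξ)) ⊗ₜ m) := by
  have h1 : kz b k M i (symι V₀ v) (ExtPow.contr i ω ξ ⊗ₜ m) =
      HeckeAlgebra.f b k v • kz b k M i 1 (ExtPow.contr i ω ξ ⊗ₜ m) := by
    rw [f_smul_kz, mul_one]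
  have h2 : ExtPow.contr i (ExtPow.map (weylAct (simpleReflection b s)) (i + 1) ω)
      (ξ ∘ₗ weylAct (simpleReflection b s)) =
        ExtPow.map (weylAct (simpleReflection b s)) i (ExtPow.contr i ω ξ) := by
    rw [← ExtPow.map_contr]
    congr 2
    exact LinearMap.ext fun v ↦ by
      simp only [LinearMap.comp_apply, weylAct_weylAct_simpleReflection]
  rw [koszulForm_apply, koszulForm_apply, h2, smul_sub, h1, HeckeAlgebra.t_smul_f_smul,
    t_smul_kz, t_smul_kz, HeckeAlgebra.t_smul_f_smul, f_smul_kz, mul_one, TensorProduct.tmul_add,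
    TensorProduct.sub_tmul, TensorProduct.tmul_smul ((k.toFun s : ℂ) * corootForm P s v), map_add,
    map_sub, LinearMap.map_smul, smul_sub]
  abel

/-- The main terms form a canonical trace over dual bases, which s preserves. The errors add up to a
multiple of (1 - s) applied to the contraction of ω with α^∨, which s fixes. -/
theorem koszulGen_equivariant (i : ℕ) (s : b.support) (u : ExtPow (ℂ ⊗[ℝ] V₀) (i + 1) ⊗[ℂ] M) :
    koszulGen b k M i (koszulRep b k M (i + 1) (simpleReflection b s) u) =
      HeckeAlgebra.t b k (simpleReflection b s) • koszulGen b k M i u := by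
  induction u using TensorProduct.induction_on with
  | zero => simp
  | add x y hx hy => rw [map_add, map_add, map_add, smul_add, hx, hy]
  | tmul ω m =>
    rw [koszulRep_tmul, koszulGen_tmul, koszulGen_tmul, Finset.smul_sum]
    simp only [t_smul_koszulForm]
    rw [Finset.sum_add_distrib]
    have h0 : ∑ j, ((k.toFun s : ℂ) * corootForm P s (complexBasis V₀ j)) • kz b k M i 1
        ((ExtPow.contr i ω ((complexBasis V₀).coord j) -
          ExtPow.map (weylAct (simpleReflection b s)) i
            (ExtPow.contr i ω ((complexBasis V₀).coord j))) ⊗ₜ m) = 0 := by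
      -- The scalars ⟨e_j, α^∨⟩ reassemble the coordinate forms into α^∨.
      have h1 : ∑ j, corootForm P s (complexBasis V₀ j) •
          ExtPow.contr i ω ((complexBasis V₀).coord j) = ExtPow.contr i ω (corootForm P s) := by
        rw [← (complexBasis V₀).sum_dual_apply_smul_coord (corootForm P s), map_sum]
        simp only [map_smul]
        rw [(complexBasis V₀).sum_dual_apply_smul_coord (corootForm P s)]
      have h2 := ExtPow.map_contr_reflection (weylAct (simpleReflection b s)) (corootForm P s)
        (1 ⊗ₜ P.root s) (weylAct_simpleReflection s) i ω
      let G : ExtPow (ℂ ⊗[ℝ] V₀) i →ₗ[ℂ] Koszul b k M i := kz b k M i 1 ∘ₗ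
        (TensorProduct.mk ℂ _ _).flip m ∘ₗ
          (LinearMap.id - ExtPow.map (weylAct (simpleReflection b s)) i)
      have h3 : G (ExtPow.contr i ω (corootForm P s)) = 0 := by
        simp only [G, LinearMap.comp_apply, LinearMap.sub_apply, LinearMap.id_apply]
        rw [h2, sub_self, map_zero, map_zero]
      rw [← h1, map_sum] at h3
      simp only [map_smul] at h3
      simp only [mul_smul]
      rw [← Finset.smul_sum]
      exact (congrArg _ h3).trans (smul_zero _)
    -- The reflection on the vectors is moved to the forms, where it meets a second copy of itself
    -- and cancels.
    have h3 := sum_basis_coord_comp (complexBasis V₀)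
      ((koszulForm b k M i (ExtPow.map (weylAct (simpleReflection b s)) (i + 1) ω)
        (HeckeAlgebra.t b k (simpleReflection b s) • m)).compl₂
          (LinearMap.lcomp ℂ ℂ (weylAct (simpleReflection b s))))
        (weylAct (simpleReflection b s))
    simp only [LinearMap.compl₂_apply, LinearMap.lcomp_apply'] at h3
    rw [h0, add_zero, h3]
    refine Finset.sum_congr rfl fun j _ ↦ congrArg _ (LinearMap.ext fun v ↦ ?_)
    simp only [LinearMap.comp_apply, weylAct_weylAct_simpleReflection]

/-- The Koszul differential. -/
def koszulD (i : ℕ) : Koszul b k M (i + 1) →ₗ[HeckeAlgebra b k] Koszul b k M i :=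
  Ind.lift (koszulGen b k M i) (koszulGen_equivariant b k M i)

theorem koszulD_tmul (i : ℕ) (p : Sym V₀) (ω : ExtPow (ℂ ⊗[ℝ] V₀) (i + 1)) (m : M) :
    koszulD b k M i (kz b k M (i + 1) p (ω ⊗ₜ m)) =
      ∑ j, (kz b k M i (p * MvPolynomial.X j) (ExtPow.contr i ω ((complexBasis V₀).coord j) ⊗ₜ m) -
        kz b k M i p (ExtPow.contr i ω ((complexBasis V₀).coord j) ⊗ₜ
          (HeckeAlgebra.f b k (complexBasis V₀ j) • m))) := by
  have h : koszulD b k M i (kz b k M (i + 1) p (ω ⊗ₜ m)) =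
      symToHecke b k p • koszulGen b k M i (ω ⊗ₜ m) := rfl
  rw [h, koszulGen_tmul, Finset.smul_sum]
  refine Finset.sum_congr rfl fun j _ ↦ ?_
  rw [koszulForm_apply, smul_sub, sym_smul_kz, sym_smul_kz, mul_one, symι_basis]

variable {M} in
theorem Koszul.induction_on {i : ℕ} {p : Koszul b k M i → Prop} (x : Koszul b k M i)
    (tmul : ∀ q ω m, p (kz b k M i q (ω ⊗ₜ m))) (add : ∀ x y, p x → p y → p (x + y)) : p x := by
  induction x using Ind.induction_on with
  | add x y hx hy => exact add x y hx hy
  | tmul q u =>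
    change p (kz b k M i q u)
    induction u using TensorProduct.induction_on with
    | zero =>
      have := tmul q 0 0
      rwa [TensorProduct.tmul_zero] at this
    | tmul ω m => exact tmul q ω m
    | add x y hx hy =>
      rw [map_add]
      exact add _ _ hx hy

/-- In the double sum the operators attached to e_j and e_l commute, on S(V) and on M, while the two
contractions anticommute. -/
theorem koszulD_koszulD (i : ℕ) (x : Koszul b k M (i + 2)) :
    koszulD b k M i (koszulD b k M (i + 1) x) = 0 := by
  induction x using Koszul.induction_on with
  | add x y hx hy => rw [map_add, map_add, hx, hy, add_zero]
  | tmul q ω m =>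
    rw [koszulD_tmul, map_sum]
    simp only [map_sub, koszulD_tmul, ← Finset.sum_sub_distrib]
    refine sum_sum_eq_zero_of_antisymm _ fun j l ↦ ?_
    rw [ExtPow.contr_contr ((complexBasis V₀).coord j), mul_right_comm, ← mul_smul, ← mul_smul,
      HeckeAlgebra.f_comm]
    simp only [TensorProduct.neg_tmul, map_neg]
    abel

/-- The contracting homotopy of the Koszul resolution, given by the de Rham differential. -/
def koszulH (i : ℕ) : Koszul b k M i →ₗ[ℂ] Koszul b k M (i + 1) :=
  ∑ j, TensorProduct.map (MvPolynomial.pderiv j).toLinearMap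
    (LinearMap.rTensor M (ExtPow.wedge (complexBasis V₀ j) i))

theorem koszulH_tmul (i : ℕ) (p : Sym V₀) (ω : ExtPow (ℂ ⊗[ℝ] V₀) i) (m : M) :
    koszulH b k M i (kz b k M i p (ω ⊗ₜ m)) =
      ∑ j, kz b k M (i + 1) (MvPolynomial.pderiv j p)
        (ExtPow.wedge (complexBasis V₀ j) i ω ⊗ₜ m) := by
  change (∑ j, TensorProduct.map (MvPolynomial.pderiv j).toLinearMap
    (LinearMap.rTensor M (ExtPow.wedge (complexBasis V₀ j) i)) :
      Sym V₀ ⊗[ℂ] (ExtPow (ℂ ⊗[ℝ] V₀) i ⊗[ℂ] M) →ₗ[ℂ] _) (p ⊗ₜ[ℂ] (ω ⊗ₜ[ℂ] m)) = _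
  rw [LinearMap.sum_apply]
  rfl

/-- The Laplacian of the Koszul resolution, up to a shift by the exterior degree. -/
def koszulL (i : ℕ) : Koszul b k M i →ₗ[ℂ] Koszul b k M i :=
  ∑ j, (TensorProduct.map (LinearMap.mulLeft ℂ (MvPolynomial.X j) ∘ₗ
      (MvPolynomial.pderiv j).toLinearMap) LinearMap.id -
    TensorProduct.map (MvPolynomial.pderiv j).toLinearMap
      (LinearMap.lTensor _ (fEnd b k M (complexBasis V₀ j))))

theorem koszulL_tmul (i : ℕ) (p : Sym V₀) (ω : ExtPow (ℂ ⊗[ℝ] V₀) i) (m : M) :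
    koszulL b k M i (kz b k M i p (ω ⊗ₜ m)) =
      ∑ j, (kz b k M i (MvPolynomial.X j * MvPolynomial.pderiv j p) (ω ⊗ₜ m) -
        kz b k M i (MvPolynomial.pderiv j p)
          (ω ⊗ₜ (HeckeAlgebra.f b k (complexBasis V₀ j) • m))) := by
  change (∑ j, (TensorProduct.map (LinearMap.mulLeft ℂ (MvPolynomial.X j) ∘ₗ
      (MvPolynomial.pderiv j).toLinearMap) LinearMap.id -
    TensorProduct.map (MvPolynomial.pderiv j).toLinearMap
      (LinearMap.lTensor _ (fEnd b k M (complexBasis V₀ j)))) :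
      Sym V₀ ⊗[ℂ] (ExtPow (ℂ ⊗[ℝ] V₀) i ⊗[ℂ] M) →ₗ[ℂ] _) (p ⊗ₜ[ℂ] (ω ⊗ₜ[ℂ] m)) = _
  rw [LinearMap.sum_apply]
  rfl

/-- A Cartan homotopy formula. The anticommutator of differential and homotopy yields the polynomial
Euler operator, a term from the action on M that lowers polynomial degree, and the exterior degree i
+ 1. -/
theorem koszulD_koszulH (i : ℕ) (x : Koszul b k M (i + 1)) :
    koszulD b k M (i + 1) (koszulH b k M (i + 1) x) + koszulH b k M i (koszulD b k M i x) =
      koszulL b k M (i + 1) x + ((i : ℂ) + 1) • x := by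
  classical
  induction x using Koszul.induction_on with
  | add x y hx hy =>
    simp only [map_add, smul_add]
    rw [add_add_add_comm, hx, hy, add_add_add_comm]
  | tmul p ω m =>
    rw [koszulH_tmul, koszulD_tmul, koszulL_tmul, map_sum, map_sum]
    simp only [map_sub, koszulD_tmul, koszulH_tmul]
    rw [← (kz b k M (i + 1) p).map_smul, TensorProduct.smul_tmul',
      ← ExtPow.sum_wedge_contr (complexBasis V₀), TensorProduct.sum_tmul, map_sum]
    simp only [← Finset.sum_sub_distrib]
    rw [Finset.sum_comm, ← Finset.sum_add_distrib, ← Finset.sum_add_distrib]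
    refine Finset.sum_congr rfl fun l _ ↦ ?_
    rw [← Finset.sum_add_distrib]
    have h1 : ∀ j, MvPolynomial.pderiv j (p * MvPolynomial.X l) =
        MvPolynomial.X l * MvPolynomial.pderiv j p + if l = j then p else 0 := by
      intro j
      rw [Derivation.leibniz, MvPolynomial.pderiv_X, Pi.single_apply]
      by_cases h : l = j
      · subst h
        simp [add_comm]
      · simp [h]
    have h2 : ∀ j, (complexBasis V₀).coord l (complexBasis V₀ j) = if l = j then 1 else 0 := by
      intro j
      rw [Module.Basis.coord_apply, Module.Basis.repr_self, Finsupp.single_apply]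
      simp only [eq_comm]
    simp only [h1, ExtPow.contr_wedge, h2]
    -- For j ≠ l the contributions of the two composites, together with the subtracted wedge terms,
    -- cancel. The diagonal carries the Laplacian.
    rw [Finset.sum_eq_single_of_mem l (Finset.mem_univ l)]
    · simp only [if_true, one_smul, TensorProduct.sub_tmul, map_sub, map_add, LinearMap.add_apply,
        mul_comm (MvPolynomial.X l)]
      abel
    · intro j _ hj
      simp only [if_neg (Ne.symm hj), zero_smul, zero_sub, TensorProduct.neg_tmul, map_neg,
        add_zero, mul_comm (MvPolynomial.X l)]
      abel

end Koszul

/-! ### Exactness of the Koszul complex -/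

section KoszulExact

variable {ι V₀ N : Type u} [AddCommGroup V₀] [Module ℝ V₀] [AddCommGroup N] [Module ℝ N]
  {P : RootPairing ι ℝ V₀ N} (b : P.Base) (k : ParameterFunction b) [FiniteDimensional ℝ V₀]
  [Finite ι] [P.IsCrystallographic] [P.IsReduced]
  (M : Type u) [AddCommGroup M] [Module (HeckeAlgebra b k) M] [Module ℂ M]
  [IsScalarTower ℂ (HeckeAlgebra b k) M]

/-- The filtration of the Koszul resolution by polynomial degree. -/
def koszulFil (i p : ℕ) : Submodule ℂ (Koszul b k M i) :=
  Submodule.span ℂ {x | ∃ s ω m, s.degree < p ∧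
    kz b k M i (MvPolynomial.monomial s 1) (ω ⊗ₜ m) = x}

theorem koszulFil_zero (i : ℕ) : koszulFil b k M i 0 = ⊥ := by
  simp [koszulFil]

theorem koszulFil_mono (i : ℕ) : Monotone (koszulFil b k M i) := by
  rintro p q hpq
  refine Submodule.span_mono ?_
  rintro x ⟨s, ω, m, hs, rfl⟩
  exact ⟨s, ω, m, hs.trans_le hpq, rfl⟩

theorem kz_monomial_mem_koszulFil {i p : ℕ} (s) (c : ℂ) (ω : ExtPow (ℂ ⊗[ℝ] V₀) i) (m : M)
    (hs : s.degree < p) :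
    kz b k M i (MvPolynomial.monomial s c) (ω ⊗ₜ m) ∈ koszulFil b k M i p := by
  have h : MvPolynomial.monomial s c = c • (MvPolynomial.monomial s 1 : Sym V₀) := by
    rw [MvPolynomial.smul_monomial, smul_eq_mul, mul_one]
  rw [h, LinearMap.map_smul, LinearMap.smul_apply]
  exact Submodule.smul_mem _ _ (Submodule.subset_span ⟨s, ω, m, hs, rfl⟩)

theorem exists_mem_koszulFil {i : ℕ} (x : Koszul b k M i) : ∃ p, x ∈ koszulFil b k M i p := by
  induction x using Koszul.induction_on with
  | add x y hx hy =>
    obtain ⟨p, hp⟩ := hx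
    obtain ⟨q, hq⟩ := hy
    exact ⟨max p q, Submodule.add_mem _ (koszulFil_mono b k M i (le_max_left p q) hp)
      (koszulFil_mono b k M i (le_max_right p q) hq)⟩
  | tmul q ω m =>
    induction q using MvPolynomial.induction_on' with
    | monomial s c =>
      exact ⟨s.degree + 1, kz_monomial_mem_koszulFil b k M s c ω m (Nat.lt_succ_self _)⟩
    | add f g hf hg =>
      obtain ⟨p, hp⟩ := hf
      obtain ⟨q, hq⟩ := hg
      refine ⟨max p q, ?_⟩
      rw [map_add, LinearMap.add_apply]
      exact Submodule.add_mem _ (koszulFil_mono b k M i (le_max_left p q) hp)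
        (koszulFil_mono b k M i (le_max_right p q) hq)

/-- On a monomial of degree d the Euler operator is the scalar d, and the rest of the Laplacian
lowers the degree. The filtration index is a strict bound, so the top degree in step p + 1 is p. -/
theorem koszulL_sub_mem {i p : ℕ} {x : Koszul b k M i} (hx : x ∈ koszulFil b k M i (p + 1)) :
    koszulL b k M i x - (p : ℂ) • x ∈ koszulFil b k M i p := by
  induction hx using Submodule.span_induction with
  | zero => simp
  | add x y _ _ hx hy =>
    rw [map_add, smul_add, add_sub_add_comm]
    exact Submodule.add_mem _ hx hy
  | smul c x _ hx =>
    rw [LinearMap.map_smul, smul_comm, ← smul_sub]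
    exact Submodule.smul_mem _ _ hx
  | mem x hx =>
    obtain ⟨s, ω, m, hs, rfl⟩ := hx
    have h1 : ∑ j, kz b k M i (MvPolynomial.X j * MvPolynomial.pderiv j
        (MvPolynomial.monomial s 1)) (ω ⊗ₜ m) =
          (s.degree : ℂ) • kz b k M i (MvPolynomial.monomial s 1) (ω ⊗ₜ m) := by
      simp only [MvPolynomial.X_mul_pderiv_monomial]
      rw [← LinearMap.sum_apply, ← map_sum, ← Finset.sum_smul, map_nsmul,
        LinearMap.smul_apply, Nat.cast_smul_eq_nsmul, Finsupp.degree_eq_sum]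
    have h2 : ∑ j, kz b k M i (MvPolynomial.pderiv j (MvPolynomial.monomial s 1))
        (ω ⊗ₜ (HeckeAlgebra.f b k (complexBasis V₀ j) • m)) ∈ koszulFil b k M i p := by
      refine Submodule.sum_mem _ fun j _ ↦ ?_
      rw [MvPolynomial.pderiv_monomial, one_mul]
      by_cases hj : s j = 0
      · rw [hj, Nat.cast_zero, map_zero, map_zero, LinearMap.zero_apply]
        exact Submodule.zero_mem _
      · refine kz_monomial_mem_koszulFil b k M _ _ ω _ ?_
        have h3 : s - Finsupp.single j 1 + Finsupp.single j 1 = s :=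
          tsub_add_cancel_of_le (Finsupp.single_le_iff.2 (Nat.one_le_iff_ne_zero.2 hj))
        have h4 := congrArg Finsupp.degree h3
        rw [map_add, Finsupp.degree_single] at h4
        omega
    rw [koszulL_tmul, Finset.sum_sub_distrib, h1, sub_right_comm, ← sub_smul]
    refine Submodule.sub_mem _ ?_ h2
    rcases (Nat.lt_succ_iff.1 hs).eq_or_lt with h | h
    · rw [h, sub_self, zero_smul]
      exact Submodule.zero_mem _
    · exact Submodule.smul_mem _ _ (kz_monomial_mem_koszulFil b k M s 1 ω m h)

/-- For a cycle z of polynomial degree at most p, the homotopy formula shows that (p + i + 1) z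
differs from a boundary by Lz - pz. This difference is again a cycle, of lower degree, hence a
boundary by induction; and p + i + 1 is nonzero. -/
theorem koszulD_exact (i : ℕ) (z : Koszul b k M (i + 1)) (hz : koszulD b k M i z = 0) :
    ∃ y, koszulD b k M (i + 1) y = z := by
  obtain ⟨p, hp⟩ := exists_mem_koszulFil b k M z
  induction p generalizing z with
  | zero =>
    rw [koszulFil_zero, Submodule.mem_bot] at hp
    exact ⟨0, by rw [map_zero, hp]⟩
  | succ p ih =>
    have h1 := koszulL_sub_mem b k M hp
    have h2 := koszulD_koszulH b k M i z
    rw [hz, map_zero, add_zero] at h2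
    have h3 : koszulL b k M (i + 1) z - (p : ℂ) • z =
        koszulD b k M (i + 1) (koszulH b k M (i + 1) z) - ((p : ℂ) + i + 1) • z := by
      rw [h2, add_assoc, add_smul (p : ℂ)]
      abel
    rw [h3] at h1
    obtain ⟨y, hy⟩ := ih _ (by
      rw [map_sub, koszulD_koszulD, LinearMap.map_smul_of_tower, hz, smul_zero, sub_zero]) h1
    have hc : (p : ℂ) + i + 1 ≠ 0 := by
      exact_mod_cast Nat.succ_ne_zero (p + i)
    refine ⟨((p : ℂ) + i + 1)⁻¹ • (koszulH b k M (i + 1) z - y), ?_⟩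
    rw [LinearMap.map_smul_of_tower, map_sub, hy, sub_sub_cancel, smul_smul, inv_mul_cancel₀ hc,
      one_smul]

/-- The identification of `⋀^0 V ⊗ M` with `M`. -/
def koszulAugGen : (ExtPow (ℂ ⊗[ℝ] V₀) 0 ⊗[ℂ] M) ≃ₗ[ℂ] M :=
  (TensorProduct.congr ExtPow.zeroEquiv (LinearEquiv.refl ℂ M)).trans (TensorProduct.lid ℂ M)

theorem koszulAugGen_tmul (ω : ExtPow (ℂ ⊗[ℝ] V₀) 0) (m : M) :
    koszulAugGen M (ω ⊗ₜ m) = ExtPow.zeroEquiv ω • m := rfl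

/-- The augmentation of the Koszul resolution. -/
def koszulAug : Koszul b k M 0 →ₗ[HeckeAlgebra b k] M :=
  Ind.lift (koszulAugGen M).toLinearMap fun i u ↦ by
    induction u using TensorProduct.induction_on with
    | zero => simp
    | add x y hx hy => rw [map_add, map_add, map_add, smul_add, hx, hy]
    | tmul ω m =>
      rw [koszulRep_tmul, LinearEquiv.coe_coe, koszulAugGen_tmul, koszulAugGen_tmul,
        ExtPow.zeroEquiv_map, smul_algebra_smul_comm]

theorem koszulAug_kz (p : Sym V₀) (u : ExtPow (ℂ ⊗[ℝ] V₀) 0 ⊗[ℂ] M) :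
    koszulAug b k M (kz b k M 0 p u) = symToHecke b k p • koszulAugGen M u := rfl

theorem koszulAug_surjective : Function.Surjective (koszulAug b k M) := fun m ↦
  ⟨kz b k M 0 1 ((koszulAugGen M).symm m), by
    rw [koszulAug_kz, map_one, one_smul, LinearEquiv.apply_symm_apply]⟩

theorem koszulAug_koszulD (x : Koszul b k M 1) : koszulAug b k M (koszulD b k M 0 x) = 0 := by
  induction x using Koszul.induction_on with
  | add x y hx hy => rw [map_add, map_add, hx, hy, add_zero]
  | tmul q ω m =>
    rw [koszulD_tmul, map_sum]
    refine Finset.sum_eq_zero fun j _ ↦ ?_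
    rw [map_sub, koszulAug_kz, koszulAug_kz, koszulAugGen_tmul, koszulAugGen_tmul, map_mul,
      symToHecke_X, mul_smul, smul_algebra_smul_comm, sub_self]

/-- The scalar p + i + 1 has no nonzero analogue for constants in homological degree zero, so the
argument is direct: the boundary of p ⊗ e_j ⊗ m is p x_j ⊗ m - p ⊗ e_j m, which lets variables be
moved onto M. -/
theorem exists_koszulD_add (x : Koszul b k M 0) :
    ∃ y u, x = koszulD b k M 0 y + kz b k M 0 1 u := by
  induction x using Koszul.induction_on with
  | add x y hx hy =>
    obtain ⟨y₁, u₁, rfl⟩ := hx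
    obtain ⟨y₂, u₂, rfl⟩ := hy
    exact ⟨y₁ + y₂, u₁ + u₂, by rw [map_add, map_add, add_add_add_comm]⟩
  | tmul q ω m =>
    classical
    induction q using MvPolynomial.induction_on generalizing m with
    | C a =>
      refine ⟨0, a • (ω ⊗ₜ m), ?_⟩
      rw [map_zero, zero_add, LinearMap.map_smul, ← LinearMap.smul_apply, ← LinearMap.map_smul,
        MvPolynomial.smul_eq_C_mul, mul_one]
    | add p q hp hq =>
      obtain ⟨y₁, u₁, h₁⟩ := hp m
      obtain ⟨y₂, u₂, h₂⟩ := hq m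
      exact ⟨y₁ + y₂, u₁ + u₂, by
        rw [map_add, LinearMap.add_apply, h₁, h₂, map_add, map_add, add_add_add_comm]⟩
    | mul_X p j hp =>
      obtain ⟨y, u, h⟩ := hp (HeckeAlgebra.f b k (complexBasis V₀ j) • m)
      refine ⟨y + kz b k M 1 p (ExtPow.wedge (complexBasis V₀ j) 0 ω ⊗ₜ m), u, ?_⟩
      rw [map_add, koszulD_tmul, Finset.sum_eq_single_of_mem j (Finset.mem_univ j)]
      · rw [ExtPow.contr_wedge_zero, Module.Basis.coord_apply, Module.Basis.repr_self,
          Finsupp.single_eq_same, one_smul, h]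
        abel
      · intro l _ hl
        rw [ExtPow.contr_wedge_zero, Module.Basis.coord_apply, Module.Basis.repr_self,
          Finsupp.single_eq_of_ne hl, zero_smul, TensorProduct.zero_tmul, TensorProduct.zero_tmul,
          map_zero, map_zero, sub_zero]

/-- Modulo boundaries x is constant in S(V), and the augmentation is bijective on constants. -/
theorem koszulAug_exact (x : Koszul b k M 0) (hx : koszulAug b k M x = 0) :
    ∃ y, koszulD b k M 0 y = x := by
  obtain ⟨y, u, rfl⟩ := exists_koszulD_add b k M x
  rw [map_add, koszulAug_koszulD, zero_add, koszulAug_kz, map_one, one_smul,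
    LinearEquiv.map_eq_zero_iff] at hx
  exact ⟨y, by rw [hx, map_zero, add_zero]⟩

theorem Koszul.subsingleton {i : ℕ} (hi : Module.finrank ℂ (ℂ ⊗[ℝ] V₀) < i) :
    Subsingleton (Koszul b k M i) := by
  have := ExtPow.subsingleton (V := ℂ ⊗[ℝ] V₀) hi
  refine subsingleton_of_forall_eq 0 fun x ↦ ?_
  induction x using Koszul.induction_on with
  | add x y hx hy => rw [hx, hy, add_zero]
  | tmul q ω m => rw [Subsingleton.elim ω 0, TensorProduct.zero_tmul, map_zero]

end KoszulExact

/-! ### Dimension shifting along a projective resolution -/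

section Resolution

universe v w

variable {C : Type v} [Category.{u} C] [Abelian C] [HasExt.{w} C]

/-- In a resolution by objects without higher extensions, extensions are finite-dimensional as
soon as the homomorphisms out of the terms of the resolution are. -/
theorem finiteDimensional_ext_of_resolution [Linear ℂ C] (A K : ℕ → C)
    (f : ∀ i, A (i + 1) ⟶ K i) (g : ∀ i, K i ⟶ A i) (w : ∀ i, f i ≫ g i = 0)
    (hS : ∀ i, (ShortComplex.mk (f i) (g i) (w i)).ShortExact) [∀ i, Projective (K i)] (Y : C)
    [∀ i, FiniteDimensional ℂ (K i ⟶ Y)] (j i : ℕ) :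
    FiniteDimensional ℂ (Abelian.Ext (A i) Y j) := by
  induction j generalizing i with
  | zero =>
    have : FiniteDimensional ℂ (A i ⟶ Y) := by
      have : Epi (g i) := (hS i).epi_g
      refine FiniteDimensional.of_injective (Linear.leftComp ℂ Y (g i)) fun a b h ↦ ?_
      exact (cancel_epi (g i)).1 h
    exact Module.Finite.equiv (Abelian.Ext.linearEquiv₀ (R := ℂ)).symm
  | succ j ih =>
    have := ih (i + 1)
    refine Module.Finite.of_surjective
      (Abelian.Ext.precompOfLinear (hS i).extClass ℂ Y (add_comm 1 j)) fun x ↦ ?_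
    exact Abelian.Ext.contravariant_sequence_exact₃ (hS i) Y x
      (Abelian.Ext.eq_zero_of_projective _) (add_comm 1 j)

/-- The bound grows by one for each step back from the vanishing syzygy A n; the objects A i are the
successive syzygies of A 0. -/
theorem hasProjectiveDimensionLT_of_resolution (A K : ℕ → C)
    (f : ∀ i, A (i + 1) ⟶ K i) (g : ∀ i, K i ⟶ A i) (w : ∀ i, f i ≫ g i = 0)
    (hS : ∀ i, (ShortComplex.mk (f i) (g i) (w i)).ShortExact) [∀ i, Projective (K i)]
    (n : ℕ) (hn : Limits.IsZero (A n)) (j i : ℕ) (hij : i + j = n) :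
    HasProjectiveDimensionLT (A i) j := by
  induction j generalizing i with
  | zero =>
    subst hij
    exact hn.hasProjectiveDimensionLT_zero
  | succ j ih =>
    have h1 : HasProjectiveDimensionLT (K i) 1 :=
      projective_iff_hasProjectiveDimensionLT_one.1 inferInstance
    exact (hS i).hasProjectiveDimensionLT_X₃ j (ih (i + 1) (by omega))
      (hasProjectiveDimensionLT_of_ge (K i) 1 (j + 1) (by omega))

end Resolution

/-! ### Finiteness of Ext over ℍ -/

section HeckeExt

variable {ι V₀ N : Type u} [AddCommGroup V₀] [Module ℝ V₀] [AddCommGroup N] [Module ℝ N]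
  {P : RootPairing ι ℝ V₀ N} {b : P.Base} {k : ParameterFunction b} [FiniteDimensional ℝ V₀]
  [Finite ι] [P.IsCrystallographic] [P.IsReduced] (M : ModuleCat.{u} (HeckeAlgebra b k))

/-- The terms of the Koszul resolution, as objects of the module category. -/
def koszulObj (i : ℕ) : ModuleCat.{u} (HeckeAlgebra b k) := ModuleCat.of _ (Koszul b k M i)

instance (i : ℕ) : Projective (koszulObj M i) := by
  have : Module.Projective (HeckeAlgebra b k) (Koszul b k M i) := Ind.projective b k _
  exact (IsProjective.iff_projective _).1 this

/-- The syzygies of the Koszul resolution. -/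
def koszulSyzygy : ℕ → ModuleCat.{u} (HeckeAlgebra b k)
  | 0 => M
  | i + 1 => ModuleCat.of _ (LinearMap.range (koszulD b k M i))

/-- The inclusion of a syzygy. -/
def koszulIncl (i : ℕ) : koszulSyzygy M (i + 1) ⟶ koszulObj M i :=
  ModuleCat.ofHom (LinearMap.range (koszulD b k M i)).subtype

/-- The projection to a syzygy. -/
def koszulProj : ∀ i : ℕ, koszulObj M i ⟶ koszulSyzygy M i
  | 0 => ModuleCat.ofHom (koszulAug b k M)
  | i + 1 => ModuleCat.ofHom (koszulD b k M i).rangeRestrict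

theorem koszulIncl_comp_koszulProj (i : ℕ) : koszulIncl M i ≫ koszulProj M i = 0 := by
  cases i with
  | zero =>
    ext ⟨_, x, rfl⟩
    exact koszulAug_koszulD b k M x
  | succ i =>
    ext ⟨_, x, rfl⟩
    exact Subtype.ext (koszulD_koszulD b k M i x)

theorem koszul_shortExact (i : ℕ) : (ShortComplex.mk (koszulIncl M i) (koszulProj M i)
    (koszulIncl_comp_koszulProj M i)).ShortExact := by
  refine ModuleCat.shortComplex_shortExact _ ?_ ?_ ?_
  · cases i with
    | zero =>
      intro x
      refine ⟨fun h ↦ ?_, ?_⟩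
      · obtain ⟨y, hy⟩ := koszulAug_exact b k M x h
        exact ⟨⟨_, y, rfl⟩, hy⟩
      · rintro ⟨⟨_, y, rfl⟩, rfl⟩
        exact koszulAug_koszulD b k M y
    | succ i =>
      intro x
      refine ⟨fun h ↦ ?_, ?_⟩
      · obtain ⟨y, hy⟩ := koszulD_exact b k M i x (congrArg Subtype.val h)
        exact ⟨⟨_, y, rfl⟩, hy⟩
      · rintro ⟨⟨_, y, rfl⟩, rfl⟩
        exact Subtype.ext (koszulD_koszulD b k M i y)
  · exact Subtype.val_injective
  · cases i with
    | zero => exact koszulAug_surjective b k M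
    | succ i => exact (koszulD b k M i).surjective_rangeRestrict

/-- The global dimension of `ℍ` is at most the dimension of `V`. -/
theorem hasProjectiveDimensionLT_hecke :
    HasProjectiveDimensionLT M (Module.finrank ℂ (ℂ ⊗[ℝ] V₀) + 1) := by
  refine hasProjectiveDimensionLT_of_resolution (koszulSyzygy M) (koszulObj M) (koszulIncl M)
    (koszulProj M) _ (koszul_shortExact M) (Module.finrank ℂ (ℂ ⊗[ℝ] V₀) + 1) ?_ _ 0 (zero_add _)
  -- With d = dim V, the syzygy of index d + 1 is the image of the Koszul term of index d + 1, which
  -- is zero.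
  have := Koszul.subsingleton b k M (Nat.lt_succ_self (Module.finrank ℂ (ℂ ⊗[ℝ] V₀)))
  have h : Subsingleton (LinearMap.range (koszulD b k M (Module.finrank ℂ (ℂ ⊗[ℝ] V₀)))) :=
    (koszulD b k M _).surjective_rangeRestrict.subsingleton
  exact ModuleCat.isZero_iff_subsingleton.2 h

/-- An ℍ-linear map out of the term is determined by its restriction to the finite-dimensional
generating space ⋀^i V ⊗ M. -/
instance finiteDimensional_koszulObj_hom [FiniteDimensional ℂ M]
    (Y : ModuleCat.{u} (HeckeAlgebra b k)) [FiniteDimensional ℂ Y] (i : ℕ) :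
    FiniteDimensional ℂ (koszulObj M i ⟶ Y) := by
  let r (φ : koszulObj M i ⟶ Y) : Koszul b k M i →ₗ[HeckeAlgebra b k] Y := φ.hom
  let ev : (koszulObj M i ⟶ Y) →ₗ[ℂ] ((ExtPow (ℂ ⊗[ℝ] V₀) i ⊗[ℂ] M) →ₗ[ℂ] Y) :=
    { toFun φ := (r φ).restrictScalars ℂ ∘ₗ kz b k M i 1
      map_add' φ ψ := rfl
      map_smul' c φ := rfl }
  refine FiniteDimensional.of_injective ev fun φ ψ h ↦ ?_
  refine ModuleCat.hom_ext (Ind.hom_ext fun u ↦ ?_)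
  exact LinearMap.congr_fun h u

theorem finiteDimensional_ext_hecke [FiniteDimensional ℂ M]
    (Y : ModuleCat.{u} (HeckeAlgebra b k)) [FiniteDimensional ℂ Y] (j : ℕ) :
    FiniteDimensional ℂ (Abelian.Ext M Y j) :=
  finiteDimensional_ext_of_resolution (koszulSyzygy M) (koszulObj M) (koszulIncl M)
    (koszulProj M) _ (koszul_shortExact M) Y j 0

end HeckeExt

/-! ### Extensions in C as invariant extensions in D -/

section InvariantExtensions

universe v₁ v₂ u₁ u₂ w₁ w₂

open Abelian

variable {C : Type u₁} [Category.{v₁} C] [Abelian C] [HasExt.{w₁} C]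
  {D : Type u₂} [Category.{v₂} D] [Abelian D] [HasExt.{w₂} D]
  (R : C ⥤ D) [R.Additive] [Limits.PreservesFiniteLimits R] [Limits.PreservesFiniteColimits R]
  (T : D ⥤ D) [T.Additive] [Limits.PreservesFiniteLimits T] [Limits.PreservesFiniteColimits T]

/-- An autoequivalence of `D` restricting to the identity on objects of `C`, in the sense of a
natural isomorphism between `R` and `R ⋙ T`, acts on extensions between such objects. -/
def extConj (η : R ≅ R ⋙ T) {X Y : C} {i : ℕ} (e : Ext.{w₂} (R.obj X) (R.obj Y) i) :
    Ext.{w₂} (R.obj X) (R.obj Y) i :=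
  (Ext.mk₀ (X := R.obj X) (Y := T.obj (R.obj X)) (η.hom.app X)).comp
    ((e.mapExactFunctor T).comp
      (Ext.mk₀ (X := T.obj (R.obj Y)) (Y := R.obj Y) (η.inv.app Y)) (add_zero i)) (zero_add i)

variable {R T} (η : R ≅ R ⋙ T)

theorem extConj_add {X Y : C} {i : ℕ} (e e' : Ext.{w₂} (R.obj X) (R.obj Y) i) :
    extConj R T η (e + e') = extConj R T η e + extConj R T η e' := by
  simp only [extConj, Ext.mapExactFunctor_add, Ext.add_comp, Ext.comp_add]

theorem extConj_smul [Linear ℂ D] [T.Linear ℂ] {X Y : C} {i : ℕ} (c : ℂ)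
    (e : Ext.{w₂} (R.obj X) (R.obj Y) i) : extConj R T η (c • e) = c • extConj R T η e := by
  simp only [extConj, Functor.mapExactFunctor_smul, Ext.smul_comp, Ext.comp_smul]

theorem extConj_mk₀ {X Y : C} (f : R.obj X ⟶ R.obj Y) : extConj R T η (Ext.mk₀ f) =
    Ext.mk₀ (η.hom.app X ≫ T.map f ≫ η.inv.app Y) := by
  simp only [extConj, Ext.mapExactFunctor_mk₀]
  rw [Ext.mk₀_comp_mk₀]
  exact Ext.mk₀_comp_mk₀ _ _

theorem extConj_comp {X Y Z : C} {i j l : ℕ} (h : i + j = l) (α : Ext.{w₂} (R.obj X) (R.obj Y) i)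
    (β : Ext.{w₂} (R.obj Y) (R.obj Z) j) :
    extConj R T η (α.comp β h) = (extConj R T η α).comp (extConj R T η β) h := by
  have h1 : (Ext.mk₀ (X := T.obj (R.obj Y)) (Y := R.obj Y) (η.inv.app Y)).comp
      (extConj R T η β) (zero_add j) = (β.mapExactFunctor T).comp
        (Ext.mk₀ (X := T.obj (R.obj Z)) (Y := R.obj Z) (η.inv.app Z)) (add_zero j) := by
    rw [extConj, Ext.mk₀_comp_mk₀_assoc]
    refine (congrArg (fun y ↦ (Ext.mk₀ y).comp _ (zero_add j)) (η.inv_hom_id_app Y)).trans ?_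
    exact Ext.mk₀_id_comp _
  rw [extConj.eq_def R T η α, Ext.comp_assoc (a₂₃ := l) _ _ _ (zero_add i) h (by omega),
    Ext.comp_assoc_of_second_deg_zero, h1, extConj, Ext.mapExactFunctor_comp,
    Ext.comp_assoc_of_third_deg_zero]

variable {A K X : C} {f : A ⟶ K} {g : K ⟶ X} {w : f ≫ g = 0}
  (hS : (ShortComplex.mk f g w).ShortExact)

/-- The components of η form a morphism from the image of the short exact sequence under R to its
image under R ⋙ T. Naturality of the extension class then lets η be moved across it and cancelled.
-/
theorem extConj_mapExactFunctor_extClass :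
    extConj R T η (X := X) (Y := A) (hS.extClass.mapExactFunctor R) =
      hS.extClass.mapExactFunctor R := by
  let c := hS.map_of_exact R
  let φ : (ShortComplex.mk f g w).map R ⟶ ((ShortComplex.mk f g w).map R).map T :=
    { τ₁ := η.hom.app A
      τ₂ := η.hom.app K
      τ₃ := η.hom.app X
      comm₁₂ := (η.hom.naturality f).symm
      comm₂₃ := (η.hom.naturality g).symm }
  have h : (c.extClass).comp (Ext.mk₀ (X := R.obj A) (Y := T.obj (R.obj A)) (η.hom.app A))
      (add_zero 1) = (Ext.mk₀ (X := R.obj X) (Y := T.obj (R.obj X)) (η.hom.app X)).comp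
        (c.map_of_exact T).extClass (zero_add 1) :=
    ShortComplex.ShortExact.extClass_naturality c (c.map_of_exact T) φ
  have h1 : hS.extClass.mapExactFunctor R = c.extClass := Ext.mapExactFunctor_extClass R hS
  have h2 : Ext.mapExactFunctor T (X := R.obj X) (Y := R.obj A) c.extClass =
    (c.map_of_exact T).extClass := Ext.mapExactFunctor_extClass T c
  rw [extConj, h1]
  refine (congrArg (fun y ↦ (Ext.mk₀ (X := R.obj X) (Y := T.obj (R.obj X)) (η.hom.app X)).comp
    (Ext.comp y (Ext.mk₀ (X := T.obj (R.obj A)) (Y := R.obj A) (η.inv.app A)) (add_zero 1))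
      (zero_add 1)) h2).trans ?_
  refine (Ext.comp_assoc_of_third_deg_zero _ _ _ _).symm.trans ?_
  refine (congrArg (fun y ↦ Ext.comp y
    (Ext.mk₀ (X := T.obj (R.obj A)) (Y := R.obj A) (η.inv.app A)) (add_zero 1)) h.symm).trans ?_
  refine (Ext.comp_assoc_of_third_deg_zero _ _ _ _).trans ?_
  refine (congrArg (fun y ↦ Ext.comp c.extClass y (add_zero 1)) (Ext.mk₀_comp_mk₀ _ _)).trans ?_
  refine (congrArg (fun y ↦ Ext.comp c.extClass (Ext.mk₀ y) (add_zero 1))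
    (η.hom_inv_id_app A)).trans ?_
  exact Ext.comp_mk₀_id _

theorem exists_extClass_comp [Projective (R.obj K)] {Y : D} {i : ℕ}
    (e : Ext.{w₂} (R.obj X) Y (i + 1)) : ∃ z : Ext.{w₂} (R.obj A) Y i,
      (hS.extClass.mapExactFunctor R).comp z (add_comm 1 i) = e := by
  have h1 : hS.extClass.mapExactFunctor R = (hS.map_of_exact R).extClass :=
    Ext.mapExactFunctor_extClass R hS
  rw [h1]
  exact Ext.contravariant_sequence_exact₃ (hS.map_of_exact R) _ e
    (Ext.eq_zero_of_projective (P := R.obj K) _) (add_comm 1 i)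

theorem exists_mk₀_comp {Y : D} {i : ℕ} (z : Ext.{w₂} (R.obj A) Y i)
    (hz : (hS.extClass.mapExactFunctor R).comp z (add_comm 1 i) = 0) :
    ∃ u : Ext.{w₂} (R.obj K) Y i, (Ext.mk₀ (R.map f)).comp u (zero_add i) = z := by
  have h1 : hS.extClass.mapExactFunctor R = (hS.map_of_exact R).extClass :=
    Ext.mapExactFunctor_extClass R hS
  rw [h1] at hz
  exact Ext.contravariant_sequence_exact₁ (hS.map_of_exact R) _ z _ hz

/-- Every object is a quotient of a projective object whose image under `R` is projective. -/
def HasProjectiveCovers (R : C ⥤ D) : Prop :=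
  ∀ X : C, ∃ (A K : C) (f : A ⟶ K) (g : K ⟶ X) (w : f ≫ g = 0),
    (ShortComplex.mk f g w).ShortExact ∧ Projective K ∧ Projective (R.obj K)

/-- In degree zero this is naturality of η. A class of higher degree is a connecting class, which is
fixed, times a class of lower degree. -/
theorem extConj_mapExactFunctor (hR : HasProjectiveCovers R) {X Y : C} {i : ℕ}
    (e : Ext.{w₁} X Y i) :
    extConj R T η (e.mapExactFunctor R) = e.mapExactFunctor R := by
  induction i generalizing X with
  | zero =>
    obtain ⟨f, rfl⟩ := (Ext.mk₀_bijective X Y).2 e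
    rw [Ext.mapExactFunctor_mk₀, extConj_mk₀]
    congr 1
    have h := η.hom.naturality_assoc f (η.inv.app Y)
    rw [η.hom_inv_id_app, Category.comp_id] at h
    exact h.symm
  | succ i ih =>
    obtain ⟨A, K, f, g, w, hS, hK, -⟩ := hR X
    obtain ⟨z, rfl⟩ := Ext.contravariant_sequence_exact₃ hS Y e
      (Ext.eq_zero_of_projective (P := K) _) (add_comm 1 i)
    rw [Ext.mapExactFunctor_comp]
    refine (extConj_comp η _ _ _).trans ?_
    rw [ih, extConj_mapExactFunctor_extClass]

/-- Involutivity on homomorphisms propagates to all degrees: projectivity of R(K) lets every class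
in D be written as a fixed connecting class times a class of lower degree. -/
theorem extConj_extConj (hR : HasProjectiveCovers R)
    (hη : ∀ {X Y : C} (f : R.obj X ⟶ R.obj Y), η.hom.app X ≫
      T.map (η.hom.app X ≫ T.map f ≫ η.inv.app Y) ≫ η.inv.app Y = f) {X Y : C} {i : ℕ}
    (e : Ext.{w₂} (R.obj X) (R.obj Y) i) : extConj R T η (extConj R T η e) = e := by
  induction i generalizing X with
  | zero =>
    obtain ⟨f, rfl⟩ := (Ext.mk₀_bijective _ _).2 e
    rw [extConj_mk₀, extConj_mk₀, hη]
  | succ i ih =>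
    obtain ⟨A, K, f, g, w, hS, -, hK⟩ := hR X
    obtain ⟨z, rfl⟩ := exists_extClass_comp hS e
    rw [extConj_comp, extConj_comp, ih, extConj_mapExactFunctor_extClass,
      extConj_mapExactFunctor_extClass]

theorem average_eq {M : Type*} [AddCommGroup M] [Module ℂ M] (a : M) :
    (1 / 2 : ℂ) • (a + a) = a := by
  rw [← two_smul ℂ a, smul_smul, one_div, inv_mul_cancel₀ two_ne_zero, one_smul]

/-- Extensions in `C` are the invariant extensions in `D`, if this holds for homomorphisms. -/
theorem mapExactFunctor_injective_and_surjective [Linear ℂ D] [T.Linear ℂ] [R.Faithful]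
    (hR : HasProjectiveCovers R)
    (hη : ∀ {X Y : C} (f : R.obj X ⟶ R.obj Y), η.hom.app X ≫
      T.map (η.hom.app X ≫ T.map f ≫ η.inv.app Y) ≫ η.inv.app Y = f)
    (hη' : ∀ {X Y : C} (f : R.obj X ⟶ R.obj Y), η.hom.app X ≫ T.map f ≫ η.inv.app Y = f →
      ∃ f', R.map f' = f) {X Y : C} {i : ℕ} :
    (∀ e : Ext.{w₁} X Y i, Ext.mapExactFunctor.{w₁, w₂} R e = 0 → e = 0) ∧
      ∀ e : Ext.{w₂} (R.obj X) (R.obj Y) i, extConj R T η e = e →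
        ∃ e' : Ext.{w₁} X Y i, e'.mapExactFunctor R = e := by
  -- The average over the involution is invariant, so the induction hypothesis lifts it to C.
  have hav {X Y : C} {i : ℕ} (e : Ext.{w₂} (R.obj X) (R.obj Y) i) :
      extConj R T η ((1 / 2 : ℂ) • (e + extConj R T η e)) =
        (1 / 2 : ℂ) • (e + extConj R T η e) := by
    rw [extConj_smul, extConj_add, extConj_extConj η hR hη, add_comm]
  induction i generalizing X with
  | zero =>
    constructor
    · intro e h
      obtain ⟨f, rfl⟩ := (Ext.mk₀_bijective X Y).2 e
      rw [Ext.mapExactFunctor_mk₀, ← Ext.mk₀_zero, ← R.map_zero] at h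
      rw [R.map_injective ((Ext.mk₀_bijective _ _).1 h), Ext.mk₀_zero]
    · intro e he
      obtain ⟨f, rfl⟩ := (Ext.mk₀_bijective _ _).2 e
      rw [extConj_mk₀] at he
      obtain ⟨f', rfl⟩ := hη' f ((Ext.mk₀_bijective _ _).1 he)
      exact ⟨Ext.mk₀ f', Ext.mapExactFunctor_mk₀ _ _⟩
  | succ i ih =>
    obtain ⟨A, K, f, g, w, hS, hK, hK'⟩ := hR X
    constructor
    · intro x hx
      obtain ⟨z, rfl⟩ := Ext.contravariant_sequence_exact₃ hS Y x
        (Ext.eq_zero_of_projective (P := K) _) (add_comm 1 i)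
      rw [Ext.mapExactFunctor_comp] at hx
      -- The image of z comes from a class u on R(K). That image is invariant, so u may be averaged
      -- and lifted to v; by injectivity in degree i, z is then the pullback of v along f, and the
      -- connecting class kills it.
      obtain ⟨u, hu⟩ := exists_mk₀_comp hS _ hx
      obtain ⟨v, hv⟩ := ih.2 _ (hav u)
      have hz : (Ext.mk₀ f).comp v (zero_add i) = z := by
        rw [← sub_eq_zero]
        refine ih.1 _ ?_
        rw [← Functor.mapExtAddHom_apply, map_sub, Functor.mapExtAddHom_apply,
          Functor.mapExtAddHom_apply, Ext.mapExactFunctor_comp, hv, Ext.comp_smul, Ext.comp_add,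
          Ext.mapExactFunctor_mk₀, hu]
        have h3 := extConj_comp η (zero_add i) (Ext.mk₀ (R.map f)) u
        rw [hu, extConj_mapExactFunctor η hR, ← Ext.mapExactFunctor_mk₀,
          extConj_mapExactFunctor η hR, Ext.mapExactFunctor_mk₀] at h3
        rw [← h3, average_eq, sub_self]
      rw [← hz]
      exact hS.extClass_comp_assoc v
    · intro e he
      obtain ⟨y, rfl⟩ := exists_extClass_comp hS e
      rw [extConj_comp, extConj_mapExactFunctor_extClass] at he
      -- Averaging y does not change its product with the connecting class, since both that class
      -- and the product are invariant.
      obtain ⟨z, hz⟩ := ih.2 _ (hav y)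
      refine ⟨hS.extClass.comp z (add_comm 1 i), ?_⟩
      rw [Ext.mapExactFunctor_comp, hz, Ext.comp_smul, Ext.comp_add, he, average_eq]

end InvariantExtensions

/-! ### Ext over ℍ ⋊ ⟨θ⟩ as θ*-invariants -/

section Comparison

variable {ι V₀ N : Type u} [AddCommGroup V₀] [Module ℝ V₀] [AddCommGroup N] [Module ℝ N]
  {P : RootPairing ι ℝ V₀ N} [Finite ι] [P.IsCrystallographic] [P.IsReduced]
  {b : P.Base} {k : ParameterFunction b}

instance : Limits.PreservesFiniteLimits (res b k) := by
  have h := ((Functor.exact_tfae (res b k)).out 1 3).mp (restrictScalars_map_exact _)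
  exact h.1

instance : Limits.PreservesFiniteColimits (res b k) := by
  have h := ((Functor.exact_tfae (res b k)).out 1 3).mp (restrictScalars_map_exact _)
  exact h.2

instance : (res b k).Linear ℂ :=
  inferInstanceAs ((ModuleCat.restrictScalars (incl b k).toRingHom).Linear ℂ)

/-- Matches restriction along the inclusion with the coefficientwise ℍ-action, for which the skew
group algebra is free over ℍ. -/
theorem incl_mul (h : HeckeAlgebra b k) (x : ExtendedHecke b k) : incl b k h * x = h • x := by
  induction x using SkewMonoidAlgebra.induction_on with
  | zero => rw [mul_zero, smul_zero]
  | add x y hx hy => rw [mul_add, smul_add, hx, hy]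
  | single g a =>
    change SkewMonoidAlgebra.single 1 h * SkewMonoidAlgebra.single g a = _
    rw [SkewMonoidAlgebra.single_mul_single, SkewMonoidAlgebra.smul_single, one_smul, one_mul,
      smul_eq_mul]

theorem exists_incl_add (x : ExtendedHecke b k) :
    ∃ h h', x = incl b k h + incl b k h' * thetaElt b k := by
  induction x using SkewMonoidAlgebra.induction_on with
  | zero => exact ⟨0, 0, by rw [map_zero, zero_mul, add_zero]⟩
  | add x y hx hy =>
    obtain ⟨h₁, h₂, rfl⟩ := hx
    obtain ⟨h₃, h₄, rfl⟩ := hy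
    exact ⟨h₁ + h₃, h₂ + h₄, by rw [map_add, map_add, add_mul, add_add_add_comm]⟩
  | single g a =>
    obtain ⟨g, rfl⟩ := Multiplicative.ofAdd.surjective g
    fin_cases g
    · exact ⟨a, 0, by rw [map_zero, zero_mul, add_zero]; rfl⟩
    · refine ⟨0, a, ?_⟩
      rw [map_zero, zero_add, incl_mul, thetaElt, SkewMonoidAlgebra.smul_single, smul_eq_mul,
        mul_one]
      rfl

/-- The standard free cover of a module over the extended algebra. -/
def freeCover (X : ModuleCat.{u} (ExtendedHecke b k)) :
    (X →₀ ExtendedHecke b k) →ₗ[ExtendedHecke b k] X :=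
  Finsupp.linearCombination (ExtendedHecke b k) id

theorem freeCover_shortExact (X : ModuleCat.{u} (ExtendedHecke b k)) :
    (freeCover X).shortComplexKer.ShortExact :=
  LinearMap.shortExact_shortComplexKer (Finsupp.linearCombination_id_surjective _ _)

instance projective_freeCover (X : ModuleCat.{u} (ExtendedHecke b k)) :
    Projective (freeCover X).shortComplexKer.X₂ :=
  (IsProjective.iff_projective (X →₀ ExtendedHecke b k)).1 inferInstance

instance projective_res_freeCover (X : ModuleCat.{u} (ExtendedHecke b k)) :
    Projective ((freeCover X).shortComplexKer.map (res b k)).X₂ := by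
  let F : ModuleCat.{u} (HeckeAlgebra b k) := ModuleCat.of _ (X →₀ ExtendedHecke b k)
  have hF : Projective F :=
    (IsProjective.iff_projective (R := HeckeAlgebra b k) (X →₀ ExtendedHecke b k)).1 inferInstance
  let E := (res b k).obj (ModuleCat.of (ExtendedHecke b k) (X →₀ ExtendedHecke b k))
  let e : (X →₀ ExtendedHecke b k) ≃ₗ[HeckeAlgebra b k] E :=
    { AddEquiv.refl (X →₀ ExtendedHecke b k) with
      map_smul' := fun h x ↦ Finsupp.ext fun y ↦ (incl_mul h (x y)).symm }
  exact Projective.of_iso (e.toModuleIso (X₁ := X →₀ ExtendedHecke b k) (X₂ := E)) hF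

theorem toTwist_comp_fromTwist (X : ModuleCat.{u} (ExtendedHecke b k)) :
    toTwist X ≫ fromTwist X = 𝟙 _ := by
  ext (x : X)
  change thetaElt b k • thetaElt b k • x = x
  rw [← mul_smul, thetaElt_mul_self, one_smul]

theorem fromTwist_comp_toTwist (X : ModuleCat.{u} (ExtendedHecke b k)) :
    fromTwist X ≫ toTwist X = 𝟙 _ := by
  ext (x : X)
  change thetaElt b k • thetaElt b k • x = x
  rw [← mul_smul, thetaElt_mul_self, one_smul]

theorem toTwist_naturality {X Y : ModuleCat.{u} (ExtendedHecke b k)} (f : X ⟶ Y) :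
    toTwist X ≫ (twist b k).map ((res b k).map f) = (res b k).map f ≫ toTwist Y := by
  ext (x : X)
  exact f.hom.map_smul (thetaElt b k) x

/-- The isomorphism `X ≅ X^θ` given by the action of `θ`. -/
def twistIso : res b k ≅ res b k ⋙ twist b k :=
  NatIso.ofComponents (fun X ↦ ⟨toTwist X, fromTwist X, toTwist_comp_fromTwist X,
    fromTwist_comp_toTwist X⟩) fun f ↦ (toTwist_naturality f).symm

theorem hasProjectiveCovers_res : HasProjectiveCovers (res b k) := fun X ↦
  ⟨_, _, _, _, _, freeCover_shortExact X, projective_freeCover X, projective_res_freeCover X⟩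

theorem twistIso_conj_conj {X Y : ModuleCat.{u} (ExtendedHecke b k)}
    (f : (res b k).obj X ⟶ (res b k).obj Y) :
    twistIso.hom.app X ≫ (twist b k).map (twistIso.hom.app X ≫ (twist b k).map f ≫
      twistIso.inv.app Y) ≫ twistIso.inv.app Y = f := by
  ext (x : X)
  change thetaElt b k • thetaElt b k • (f.hom (thetaElt b k • thetaElt b k • x : X) : Y) = f.hom x
  rw [← mul_smul, ← mul_smul, thetaElt_mul_self, one_smul, one_smul]

/-- Invariance under conjugation by θ means commuting with θ, because θ² = 1; and ℍ ⋊ ⟨θ⟩ = ℍ + ℍθ.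
-/
theorem exists_map_eq_of_twistIso_conj {X Y : ModuleCat.{u} (ExtendedHecke b k)}
    (f : (res b k).obj X ⟶ (res b k).obj Y)
    (hf : twistIso.hom.app X ≫ (twist b k).map f ≫ twistIso.inv.app Y = f) :
    ∃ f', (res b k).map f' = f := by
  let g : X → Y := fun x ↦ f.hom x
  have hg : ∀ x : X, g (thetaElt b k • x) = thetaElt b k • g x := by
    intro x
    have h1 : thetaElt b k • g (thetaElt b k • x) = g x :=
      congrArg (fun φ : (res b k).obj X ⟶ (res b k).obj Y ↦ φ.hom x) hf
    rw [← h1, ← mul_smul, thetaElt_mul_self, one_smul]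
  have hi : ∀ h (x : X), g (incl b k h • x) = incl b k h • g x := fun h x ↦ f.hom.map_smul h x
  have ha : ∀ x y : X, g (x + y) = g x + g y := fun x y ↦ f.hom.map_add x y
  let F : X →ₗ[ExtendedHecke b k] Y :=
    { toFun := g
      map_add' := ha
      map_smul' := fun r x ↦ by
        obtain ⟨h, h', rfl⟩ := exists_incl_add r
        rw [add_smul, ha, hi, mul_smul, hi, hg, RingHom.id_apply, add_smul, mul_smul] }
  exact ⟨ModuleCat.ofHom F, rfl⟩

/-- By definition `thetaStar` is `extConj` for `twistIso`, so the abstract results apply verbatim.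
-/
theorem thetaStar_thetaStar {X Y : ModuleCat.{u} (ExtendedHecke b k)} {i : ℕ}
    (e : ExtH X Y i) : thetaStar X Y i (thetaStar X Y i e) = e :=
  extConj_extConj twistIso hasProjectiveCovers_res twistIso_conj_conj e

/-- Restriction of extensions from the extended algebra to `ℍ`. -/
def resExt (X Y : ModuleCat.{u} (ExtendedHecke b k)) (i : ℕ) : ExtHTheta X Y i →ₗ[ℂ] ExtH X Y i :=
  (res b k).mapExtLinearMap ℂ X Y i

theorem thetaStar_resExt {X Y : ModuleCat.{u} (ExtendedHecke b k)} {i : ℕ}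
    (e : ExtHTheta X Y i) : thetaStar X Y i (resExt X Y i e) = resExt X Y i e :=
  extConj_mapExactFunctor twistIso hasProjectiveCovers_res e

theorem resExt_injective_and_surjective (X Y : ModuleCat.{u} (ExtendedHecke b k)) (i : ℕ) :
    (∀ e : ExtHTheta X Y i, resExt X Y i e = 0 → e = 0) ∧
      ∀ e : ExtH X Y i, thetaStar X Y i e = e → ∃ e', resExt X Y i e' = e :=
  mapExactFunctor_injective_and_surjective (X := X) (Y := Y) (i := i) (twistIso (b := b) (k := k))
    hasProjectiveCovers_res twistIso_conj_conj exists_map_eq_of_twistIso_conj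

theorem resExt_injective (X Y : ModuleCat.{u} (ExtendedHecke b k)) (i : ℕ) :
    Function.Injective (resExt X Y i) :=
  (injective_iff_map_eq_zero _).2 (resExt_injective_and_surjective X Y i).1

/-- Extensions over the extended algebra are the `θ^*`-invariant extensions over `ℍ`. -/
theorem range_resExt (X Y : ModuleCat.{u} (ExtendedHecke b k)) (i : ℕ) :
    LinearMap.range (resExt X Y i) = LinearMap.ker (thetaStar X Y i - LinearMap.id) := by
  ext e
  rw [LinearMap.mem_ker, LinearMap.sub_apply, LinearMap.id_apply, sub_eq_zero]
  refine ⟨?_, (resExt_injective_and_surjective X Y i).2 e⟩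
  rintro ⟨e', rfl⟩
  exact thetaStar_resExt e'

end Comparison

/-! ### Traces, dimensions and Euler-Poincaré pairings -/

section DimensionFormula

/-- The dimension of the space of invariants of an involution. -/
theorem finrank_ker_sub_id_of_involutive {A : Type*} [AddCommGroup A] [Module ℂ A]
    [FiniteDimensional ℂ A] (τ : A →ₗ[ℂ] A) (hτ : ∀ a, τ (τ a) = a) :
    (Module.finrank ℂ (LinearMap.ker (τ - LinearMap.id)) : ℂ) =
      1 / 2 * (Module.finrank ℂ A : ℂ) + 1 / 2 * LinearMap.trace ℂ A τ := by
  -- The trace of a projection is the dimension of its image.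
  have hp : LinearMap.IsProj (LinearMap.ker (τ - LinearMap.id))
      ((1 / 2 : ℂ) • (LinearMap.id + τ)) := by
    constructor
    · intro a
      rw [LinearMap.mem_ker, LinearMap.sub_apply, LinearMap.id_apply, sub_eq_zero,
        LinearMap.smul_apply, LinearMap.add_apply, LinearMap.id_apply, map_smul, map_add, hτ,
        add_comm]
    · intro a ha
      rw [LinearMap.mem_ker, LinearMap.sub_apply, LinearMap.id_apply, sub_eq_zero] at ha
      rw [LinearMap.smul_apply, LinearMap.add_apply, LinearMap.id_apply, ha, average_eq]
  rw [← hp.trace, map_smul, map_add, LinearMap.trace_id, smul_add, smul_eq_mul, smul_eq_mul]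

variable {ι V₀ N : Type u} [AddCommGroup V₀] [Module ℝ V₀] [FiniteDimensional ℝ V₀]
  [AddCommGroup N] [Module ℝ N]
  {P : RootPairing ι ℝ V₀ N} [Finite ι] [P.IsCrystallographic] [P.IsReduced]
  {b : P.Base} {k : ParameterFunction b} (X Y : ModuleCat.{u} (ExtendedHecke b k))

/-- The complex structures on the two sides come from different algebras; they agree because the
inclusion is ℂ-linear. -/
instance finiteDimensional_res [h : FiniteDimensional ℂ X] :
    FiniteDimensional ℂ ((res b k).obj X) := by
  let e : X →ₗ[ℂ] (res b k).obj X :=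
    { toFun := fun x ↦ x
      map_add' := fun _ _ ↦ rfl
      map_smul' := fun c (x : X) ↦ by
        change algebraMap ℂ (ExtendedHecke b k) c • x =
          incl b k (algebraMap ℂ (HeckeAlgebra b k) c) • x
        rw [AlgHom.commutes] }
  exact Module.Finite.of_surjective e fun x ↦ ⟨x, rfl⟩

theorem finiteDimensional_extH [FiniteDimensional ℂ X] [FiniteDimensional ℂ Y] (i : ℕ) :
    FiniteDimensional ℂ (ExtH X Y i) :=
  finiteDimensional_ext_hecke ((res b k).obj X) ((res b k).obj Y) i

theorem finiteDimensional_extHTheta [FiniteDimensional ℂ X] [FiniteDimensional ℂ Y] (i : ℕ) :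
    FiniteDimensional ℂ (ExtHTheta X Y i) :=
  haveI := finiteDimensional_extH X Y i
  FiniteDimensional.of_injective (resExt X Y i) (resExt_injective X Y i)

theorem subsingleton_extH {i : ℕ} (hi : Module.finrank ℂ (ℂ ⊗[ℝ] V₀) < i) :
    Subsingleton (ExtH X Y i) :=
  haveI := hasProjectiveDimensionLT_hecke ((res b k).obj X)
  HasProjectiveDimensionLT.subsingleton ((res b k).obj X) _ i hi ((res b k).obj Y)

theorem subsingleton_extHTheta {i : ℕ} (hi : Module.finrank ℂ (ℂ ⊗[ℝ] V₀) < i) :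
    Subsingleton (ExtHTheta X Y i) :=
  haveI := subsingleton_extH X Y hi
  (resExt_injective X Y i).subsingleton

theorem finrank_extHTheta [FiniteDimensional ℂ X] [FiniteDimensional ℂ Y] (i : ℕ) :
    (Module.finrank ℂ (ExtHTheta X Y i) : ℂ) =
      1 / 2 * (Module.finrank ℂ (ExtH X Y i) : ℂ) +
        1 / 2 * LinearMap.trace ℂ (ExtH X Y i) (thetaStar X Y i) := by
  have := finiteDimensional_extH X Y i
  rw [← finrank_ker_sub_id_of_involutive (thetaStar X Y i) thetaStar_thetaStar, ← range_resExt,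
    LinearMap.finrank_range_of_inj (resExt_injective X Y i)]

theorem ePHTheta_eq [FiniteDimensional ℂ X] [FiniteDimensional ℂ Y] :
    (EPHTheta X Y : ℂ) = 1 / 2 * (EPH X Y : ℂ) + 1 / 2 * EPTwisted X Y := by
  -- A `finsum` with infinite support would be zero by convention; vanishing above dim V turns all
  -- three into sums over the same finite range.
  have hsupp {R : Type} [AddCommMonoid R] {φ : ℕ → R}
      (h : ∀ i, Module.finrank ℂ (ℂ ⊗[ℝ] V₀) < i → φ i = 0) :
      Function.support φ ⊆ Finset.range (Module.finrank ℂ (ℂ ⊗[ℝ] V₀) + 1) := by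
    intro i hi
    rw [Finset.coe_range, Set.mem_Iio, Nat.lt_succ_iff]
    exact not_lt.1 fun h' ↦ hi (h i h')
  rw [EPHTheta, EPH, EPTwisted, finsum_eq_sum_of_support_subset _ (hsupp fun i hi ↦ ?_),
    finsum_eq_sum_of_support_subset _ (hsupp fun i hi ↦ ?_),
    finsum_eq_sum_of_support_subset _ (hsupp fun i hi ↦ ?_)]
  · push_cast
    rw [Finset.mul_sum, Finset.mul_sum, ← Finset.sum_add_distrib]
    refine Finset.sum_congr rfl fun i _ ↦ ?_
    rw [finrank_extHTheta]
    ring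
  · have := subsingleton_extH X Y hi
    rw [Subsingleton.elim (thetaStar X Y i) 0, map_zero, mul_zero]
  · have := subsingleton_extH X Y hi
    rw [Module.finrank_zero_of_subsingleton, Nat.cast_zero, mul_zero]
  · have := subsingleton_extHTheta X Y hi
    rw [Module.finrank_zero_of_subsingleton, Nat.cast_zero, mul_zero]

end DimensionFormula

end GradedHecke

end

theorem mainTheorem5 {ι V₀ N : Type u} [Finite ι] [AddCommGroup V₀] [Module ℝ V₀]
    [FiniteDimensional ℝ V₀] [AddCommGroup N] [Module ℝ N]
    (P : RootPairing ι ℝ V₀ N) [P.IsCrystallographic] [P.IsReduced] (b : P.Base)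
    (k : GradedHecke.ParameterFunction b)
    (X Y : ModuleCat.{u} (GradedHecke.ExtendedHecke b k))
    [FiniteDimensional ℂ X] [FiniteDimensional ℂ Y] :
    -- all the spaces involved are finite-dimensional, and almost all of them vanish
    (∀ i : ℕ, FiniteDimensional ℂ (GradedHecke.ExtH X Y i) ∧
      FiniteDimensional ℂ (GradedHecke.ExtHTheta X Y i)) ∧
    (∃ n : ℕ, ∀ i : ℕ, n < i → Subsingleton (GradedHecke.ExtH X Y i) ∧
      Subsingleton (GradedHecke.ExtHTheta X Y i)) ∧
    -- the dimension formula
    (∀ i : ℕ, (Module.finrank ℂ (GradedHecke.ExtHTheta X Y i) : ℂ) =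
      1 / 2 * (Module.finrank ℂ (GradedHecke.ExtH X Y i) : ℂ) +
        1 / 2 * LinearMap.trace ℂ (GradedHecke.ExtH X Y i) (GradedHecke.thetaStar X Y i)) ∧
    -- the formula for the Euler-Poincaré pairings
    (GradedHecke.EPHTheta X Y : ℂ) =
      1 / 2 * (GradedHecke.EPH X Y : ℂ) + 1 / 2 * GradedHecke.EPTwisted X Y := by
  exact ⟨fun i ↦ ⟨GradedHecke.finiteDimensional_extH X Y i,
      GradedHecke.finiteDimensional_extHTheta X Y i⟩,
    ⟨_, fun i hi ↦ ⟨GradedHecke.subsingleton_extH X Y hi,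
      GradedHecke.subsingleton_extHTheta X Y hi⟩⟩,
    GradedHecke.finrank_extHTheta X Y, GradedHecke.ePHTheta_eq X Y⟩
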